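/- **Setting.** Let $X$ be a $\sigma$-compact metric space with its Borel $\sigma$-algebra and a $\sigma$-finite diffuse measure $\sigma$, and let $(Y,\mu)$ be a measure space. Let $\Omega^X$ be the space of locally finite subsets $\omega$ of $X$, identified with the point measures $\omega(dx)=\sum_{x\in\omega}\varepsilon_x(dx)$, with the $\sigma$-algebra generated by the counts $\omega\mapsto\omega(A)$. Let $\pi_\sigma$ be the Poisson measure on $\Omega^X$ with intensity $\sigma$, and $E_\sigma$ its expectation. For $F:\Omega^X\to\mathbb R$ let $D_xF(\omega)=F(\omega\cup\{x\})-F(\omega)$, and for a measurable process $u:\Omega^X\times X\to\mathbb R$ let $$\delta_\sigma(u)(\omega)=\int_X u_t(\omega\setminus\{t\})\,(\omega(dt)-\sigma(dt)).$$ $\mathbb L_{2,1}$ denotes the set of measurable processes $u$ with $E_\sigma\left[\int_X u_t^2\,\sigma(dt)\right]+E_\sigma\left[\int_X\int_X|D_su_t|^2\,\sigma(ds)\,\sigma(dt)\right]<\infty$. For processes $v_0,\dots,v_j$ and $s_0,\dots,s_j\in X$ let $$\Delta_{s_0}\cdots\Delta_{s_j}\Big(\prod_{p=0}^j v_p(s_p)\Big)=\sum_{\substack{\Theta_0\cup\cdots\cup\Theta_j=\{s_0,\dots,s_j\}\\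 s_0\notin\Theta_0,\dots,s_j\notin\Theta_j}}D_{\Theta_0}v_0(s_0)\cdots D_{\Theta_j}v_j(s_j),\qquad D_\Theta=\prod_{s\in\Theta}D_s .$$ **Proposition 3.1.** Let $N\ge0$ and let $R(\omega):L^p_\mu(Y)\to L^p_\sigma(X)$, $\omega\in\Omega^X$, $p=1,\dots,N+1$, be a random isometry: for each $\omega$, $R(\omega)$ is a linear, positivity preserving operator which is isometric on $L^p$ for every $p=1,\dots,N+1$ and does not depend on $p$ (for example $R(\omega)h=h\circ\tau(\omega,\cdot)$ where $\tau(\omega,\cdot):X\to Y$ maps $\sigma$ to $\mu$). Let $h\in\bigcap_{p=1}^{N+1}L^p_\mu(Y)$ be such that $Rh$ is (that is, has a version which is) an essentially bounded process in $\mathbb L_{2,1}$, and such that $$E_\sigma\left[\int_{X^{a+1}}\Big|\Delta_{s_0}\cdots\Delta_{s_a}\Big(\prod_{p=0}^a (Rh(s_p))^{l_p}\Big)\Big|\,\sigma(ds_0)\cdots\sigma(ds_a)\right]<\infty$$ for all $a\ge0$ and $l_0,\dots,l_a\ge1$ with $l_0+\cdots+l_a\le N+1$. Then for every $n=0,\dots,N$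 we have $\delta_\sigma(Rh)\in L^{n+1}(\Omega^X,\pi_\sigma)$ and $$\begin{aligned}E_\sigma[\delta_\sigma(Rh)^{n+1}]={}&\sum_{k=0}^{n-1}\binom nk\int_Y h^{n-k+1}\,d\mu\;E_\sigma[\delta_\sigma(Rh)^k]\\&+\sum_{a=0}^n\sum_{j=0}^a\sum_{b=a}^n\ \sum_{\substack{l_0+\cdots+l_a=n-b\\ l_0,\dots,l_a\ge0\\ l_{a+1},\dots,l_b=0}}\binom aj\,C^{l_0,n}_{\mathfrak L_a,b}\Big(\prod_{q=j+1}^b\int_Y h^{1+l_q}\,d\mu\Big)\\&\qquad\times E_\sigma\left[\int_{X^{j+1}}\Delta_{s_0}\cdots\Delta_{s_j}\Big(\prod_{p=0}^j(Rh(s_p))^{1+l_p}\Big)\,\sigma(ds_0)\cdots\sigma(ds_j)\right],\end{aligned}$$ where $\mathfrak L_a=(l_1,\dots,l_a)$ and $$C^{l_0,n}_{\mathfrak L_a,a+c}=(-1)^c\binom n{l_0}\,\frac{(l_1+\cdots+l_a+a+c)!}{a!\,c!\,(1+l_1)!\cdots(1+l_a)!}.$$ -/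

import Mathlib

open MeasureTheory ProbabilityTheory
open scoped ENNReal NNReal Nat

noncomputable section

namespace PoissonInvariance

/-- The configuration space over `X`: subsets of `X` that are locally finite, i.e. have finitely
many points in every compact set. (Over a σ-compact space such a set is at most countable.) -/
structure Configuration (X : Type*) [TopologicalSpace X] where
  /-- the set of points of the configuration -/
  carrier : Set X
  finite_inter_compact : ∀ K : Set X, IsCompact K → (carrier ∩ K).Finite

namespace Configuration

variable {X : Type*} [TopologicalSpace X]

/-- The configuration `ω ∪ {x}`. -/
def insert (ω : Configuration X) (x : X) : Configuration X where
  carrier := ω.carrier ∪ {x}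
  finite_inter_compact K hK := by
    rw [Set.union_inter_distrib_right]
    exact (ω.finite_inter_compact K hK).union ((Set.finite_singleton x).inter_of_left K)

/-- The configuration `ω \ {x}`. -/
def erase (ω : Configuration X) (x : X) : Configuration X where
  carrier := ω.carrier \ {x}
  finite_inter_compact K hK :=
    (ω.finite_inter_compact K hK).subset (Set.inter_subset_inter_left K Set.sdiff_subset)

/-- The point measure `∑_{x ∈ ω} ε_x`. -/
def toMeasure [MeasurableSpace X] (ω : Configuration X) : Measure X :=
  Measure.sum fun x : ω.carrier => Measure.dirac (x : X)

/-- The σ-algebra on the configuration space generated by the counting maps `ω ↦ ω(A)`,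
`A` measurable. -/
instance [MeasurableSpace X] : MeasurableSpace (Configuration X) :=
  MeasurableSpace.comap toMeasure inferInstance

end Configuration

variable {X : Type*} [TopologicalSpace X] [MeasurableSpace X]

/-- `π` is the Poisson measure on the configuration space with intensity `σ`: it is a
probability measure under which `ω(A)` is Poisson distributed with parameter `σ(A)` for every
measurable `A` with `σ(A) < ∞`, and the counts of pairwise disjoint such sets are independent. -/
structure IsPoisson (σ : Measure X) (π : Measure (Configuration X)) : Prop where
  isProbabilityMeasure : IsProbabilityMeasure π
  map_count : ∀ A : Set X, MeasurableSet A → σ A < ∞ →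
    π.map (fun ω => ω.toMeasure A) =
      (poissonMeasure (σ A).toNNReal).map (fun k : ℕ => (k : ℝ≥0∞))
  iIndepFun_count : ∀ (n : ℕ) (A : Fin n → Set X), (∀ i, MeasurableSet (A i)) →
    (∀ i, σ (A i) < ∞) → Pairwise (fun i j => Disjoint (A i) (A j)) →
    iIndepFun (fun i ω => Configuration.toMeasure ω (A i)) π

/-- The finite difference gradient `D_x F(ω) = F(ω ∪ {x}) - F(ω)`. -/
def gradD (x : X) (F : Configuration X → ℝ) : Configuration X → ℝ :=
  fun ω => F (ω.insert x) - F ω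

/-- The iterated gradient `D_Θ F = (∏_{i ∈ Θ} D_{s_i}) F`, for a set `Θ` of indices of the
points `s_0, …, s_{m-1}`. -/
def gradSet {m : ℕ} (s : Fin m → X) (Θ : Finset (Fin m)) (F : Configuration X → ℝ) :
    Configuration X → ℝ :=
  ((List.finRange m).filter (fun i => i ∈ Θ)).foldr (fun i G => gradD (s i) G) F

open Classical in
/-- `Δ_{s_0} ⋯ Δ_{s_j} (∏_{p=0}^{j} v_p(s_p))` evaluated at `ω`, for `m = j + 1` processes `v_p`:
the sum of `∏_p D_{Θ_p} v_p(s_p)` over all families `(Θ_p)_p` of subsets of the indices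
`0, …, j` whose union is everything and such that `p ∉ Θ_p` for all `p`. -/
def bigDelta {m : ℕ} (v : Fin m → Configuration X → X → ℝ) (s : Fin m → X)
    (ω : Configuration X) : ℝ :=
  ∑ Θ : Fin m → Finset (Fin m) with
      (Finset.univ.biUnion Θ = Finset.univ ∧ ∀ p, p ∉ Θ p),
    ∏ p, gradSet s (Θ p) (fun η => v p η (s p)) ω

/-- The Poisson-Skorohod integral
`δ_σ(u)(ω) = ∫_X u_t(ω \ {t}) (ω(dt) - σ(dt))`. -/
def skorohod (σ : Measure X) (u : Configuration X → X → ℝ) (ω : Configuration X) : ℝ :=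
  (∫ t, u (ω.erase t) t ∂ω.toMeasure) - ∫ t, u (ω.erase t) t ∂σ

/-- The space `𝕃_{2,1}` of measurable processes with
`E[∫ u_t² σ(dt)] + E[∫∫ |D_s u_t|² σ(ds) σ(dt)] < ∞`. -/
structure MemL21 (σ : Measure X) (π : Measure (Configuration X))
    (u : Configuration X → X → ℝ) : Prop where
  measurable : Measurable (Function.uncurry u)
  sq_lt_top : ∫⁻ ω, ∫⁻ t, ‖u ω t‖ₑ ^ 2 ∂σ ∂π < ∞
  grad_sq_lt_top : ∫⁻ ω, ∫⁻ s, ∫⁻ t, ‖gradD s (fun η => u η t) ω‖ₑ ^ 2 ∂σ ∂σ ∂π < ∞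

instance factOneLe (k : ℕ) : Fact ((1 : ℝ≥0∞) ≤ (k : ℝ≥0∞) + 1) := ⟨le_add_self⟩

/-- A random (linear, positivity preserving) isometry from `L^p_μ(Y)` to `L^p_σ(X)`
for all `p = 1, …, N + 1`. The index `p : Fin (N + 1)` stands for the exponent `p + 1`. -/
structure RandomIsometry (N : ℕ) {Y : Type*} [MeasurableSpace Y] (μ : Measure Y)
    (σ : Measure X) where
  /-- the isometry `R(ω)` on each of the spaces `L^{p+1}` -/
  toIsometry : Configuration X → (p : Fin (N + 1)) →
    (Lp ℝ (((p : ℕ) : ℝ≥0∞) + 1) μ →ₗᵢ[ℝ] Lp ℝ (((p : ℕ) : ℝ≥0∞) + 1) σ)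
  /-- `R(ω)` does not depend on the space in which a function is considered -/
  compatible : ∀ ω (p q : Fin (N + 1)) (f : Lp ℝ (((p : ℕ) : ℝ≥0∞) + 1) μ)
    (g : Lp ℝ (((q : ℕ) : ℝ≥0∞) + 1) μ), f =ᵐ[μ] g → toIsometry ω p f =ᵐ[σ] toIsometry ω q g
  /-- `R(ω)` maps nonnegative functions to nonnegative functions -/
  nonneg : ∀ ω (p : Fin (N + 1)) (f : Lp ℝ (((p : ℕ) : ℝ≥0∞) + 1) μ),
    0 ≤ f → 0 ≤ toIsometry ω p f

/-- The process `u` is a version of `Rh`: for almost all `ω`, `u(ω, ·) = R(ω)h` almost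
everywhere. -/
def IsVersion {N : ℕ} {Y : Type*} [MeasurableSpace Y] {μ : Measure Y} {σ : Measure X}
    (π : Measure (Configuration X)) (R : RandomIsometry N μ σ) (h : Y → ℝ)
    (hh : ∀ p : Fin (N + 1), MemLp h (((p : ℕ) : ℝ≥0∞) + 1) μ)
    (u : Configuration X → X → ℝ) : Prop :=
  ∀ᵐ ω ∂π, ∀ p : Fin (N + 1), u ω =ᵐ[σ] R.toIsometry ω p ((hh p).toLp h)

/-- The finite sequence `l_0, …, l_a` continued by `l_q = 0` for `q > a`. -/
def extendZero {a : ℕ} (l : Fin (a + 1) → ℕ) (q : ℕ) : ℕ :=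
  if hq : q < a + 1 then l ⟨q, hq⟩ else 0

/-- The coefficient `C_{(l_1,…,l_a), a+c}^{l_0, n}`, namely
`(-1)^c (n choose l_0) (l_1 + ⋯ + l_a + a + c)! / (a! c! ∏_{p=1}^a (1 + l_p)!)`. The last factor
is `1 / a!` times the number of ways to choose pairwise disjoint blocks `B_1, …, B_a` of sizes
`1 + l_1, …, 1 + l_a` in a set of `l_1 + ⋯ + l_a + a + c` elements, leaving `c` singletons. -/
def coeffC (n a c : ℕ) (l : Fin (a + 1) → ℕ) : ℝ :=
  (-1) ^ c * (n.choose (l 0) : ℝ) *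
    ((((∑ p : Fin a, l p.succ) + a + c)! : ℕ) /
      ((a ! : ℝ) * (c ! : ℝ) * ∏ p : Fin a, ((1 + l p.succ)! : ℝ)))

end PoissonInvariance

end

set_option linter.unusedSectionVars false

noncomputable section

namespace PoissonInvariance

/-! ### Configurations, measurability, and the counting kernel. -/

section

namespace Configuration

section Basic

variable {X : Type*} [TopologicalSpace X]

/-! A positivity preserving isometry fixes every moment: almost surely `∫ u(ω)^k dσ` is the
deterministic number `H k = ∫ h^k dμ` for `1 ≤ k ≤ N + 1`. As `σ` is diffuse, `δ(u) = S - H 1`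
almost surely, where `S(ω) = ∫ u_t(ω \ {t}) ω(dt)`, so only moments of `S` have to be understood.

The Mecke formula (`compProd_countKernel`) trades an integral against `ω(dt)` for one against
`σ(dt)` with `t` added to `ω`. Applied to the factors of `S^i` one after the other, it gives a sum
over the partitions of `i` elements (`mixedMoment_succ_aux`, `mixedMoment_eq_partitionSum`): a block
of size `k_p` becomes one variable `s_p` with exponent `k_p`, and the summand is the joint moment
`Φ(k) = E ∫ ∏_p u(s_p)^{k_p}(ω ∪ {s_q : q ≠ p}) σ(ds)`.

Möbius inversion over subsets links `Φ` with `Δ`. The quantity `Δ` is the alternating sum over `S`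
of the products in which only the points indexed by `S` are added (`bigDelta_eq`). A variable
outside `S` then enters no configuration, and integrating it out leaves the constant `H (k_q)`.
Hence `E ∫ Δ = ∑_T ∏_{i ∉ T} (-H (k_i)) Φ(k_T)` (`integral_bigDelta`), a relation that can be
inverted. Its absolute version, by induction on the number of variables, also shows that the joint
moments are finite (`jointAbsMoment_fin_lt_top`).

For the recursion, `δ^{n+1} = S δ^n - H 1 δ^n`, and the block containing the distinguished factor
`S` is singled out. Writing `Φ(k₀, l) = H k₀ Φ(l) + remainder`, the main term produces lower moments
of `δ`, except for a multiple of `E δ^n` that cancels against `-H 1 E δ^n`. The remainder is a sum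
over the index sets containing the distinguished block, that is, of integrals of `Δ`; by symmetry
only the size of the set matters, whence the binomial coefficients (`centered_expansion`). -/

@[ext]
theorem ext {ω η : Configuration X} (h : ω.carrier = η.carrier) : ω = η := by
  cases ω; cases η; cases h; rfl

theorem countable_carrier [SigmaCompactSpace X] (ω : Configuration X) : ω.carrier.Countable := by
  have : ω.carrier = ⋃ n, ω.carrier ∩ compactCovering X n := by
    rw [← Set.inter_iUnion, iUnion_compactCovering, Set.inter_univ]
  rw [this]
  exact Set.countable_iUnion fun n =>
    (ω.finite_inter_compact _ (isCompact_compactCovering X n)).countable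

theorem insert_erase (ω : Configuration X) (x : X) : (ω.erase x).insert x = ω.insert x := by
  ext1; simp [insert, erase]

theorem erase_insert {ω : Configuration X} {x : X} (h : x ∉ ω.carrier) :
    (ω.insert x).erase x = ω := by
  ext1; simp [insert, erase, h]

theorem erase_eq {ω : Configuration X} {x : X} (h : x ∉ ω.carrier) : ω.erase x = ω := by
  ext1; simp [erase, h]

variable [MeasurableSpace X]

theorem toMeasure_apply (ω : Configuration X) {A : Set X} (hA : MeasurableSet A) :
    ω.toMeasure A = ∑' x, ω.carrier.indicator (A.indicator 1) x := by
  rw [toMeasure, Measure.sum_apply _ hA, ← tsum_subtype]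
  simp [Measure.dirac_apply' _ hA]

theorem lintegral_toMeasure [MeasurableSingletonClass X] (ω : Configuration X) (f : X → ℝ≥0∞) :
    ∫⁻ x, f x ∂ω.toMeasure = ∑' x : ω.carrier, f x := by
  rw [toMeasure, lintegral_sum_measure]
  simp

theorem ae_toMeasure_iff [MeasurableSingletonClass X] [SigmaCompactSpace X] (ω : Configuration X)
    {p : X → Prop} : (∀ᵐ x ∂ω.toMeasure, p x) ↔ ∀ x ∈ ω.carrier, p x := by
  have := ω.countable_carrier.to_subtype
  rw [toMeasure, Measure.ae_sum_iff]
  simp [ae_dirac_eq]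

theorem toMeasure_lt_top [MeasurableSingletonClass X] (ω : Configuration X) {K : Set X}
    (hK : IsCompact K) (hKm : MeasurableSet K) : ω.toMeasure K < ∞ := by
  rw [ω.toMeasure_apply hKm, Set.indicator_indicator,
    tsum_eq_sum (s := (ω.finite_inter_compact K hK).toFinset)]
  · exact ENNReal.sum_lt_top.2 fun x _ => by
      by_cases h : x ∈ ω.carrier ∩ K <;> simp [Set.indicator, h]
  · intro x hx
    rw [Set.Finite.mem_toFinset] at hx
    simp [Set.indicator_of_notMem hx]

theorem toMeasure_erase [MeasurableSingletonClass X] (ω : Configuration X) (x : X) :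
    (ω.erase x).toMeasure = ω.toMeasure.restrict {x}ᶜ := by
  ext A hA
  rw [Measure.restrict_apply hA, toMeasure_apply _ hA,
    toMeasure_apply _ (hA.inter (measurableSet_singleton x).compl)]
  simp only [Set.indicator_indicator]
  congr 1; ext y; congr 1; ext z
  simp [erase]; tauto

theorem toMeasure_insert [MeasurableSingletonClass X] {ω : Configuration X} {x : X}
    (h : x ∉ ω.carrier) : (ω.insert x).toMeasure = ω.toMeasure + Measure.dirac x := by
  ext A hA
  rw [Measure.add_apply, toMeasure_apply _ hA, toMeasure_apply _ hA, insert,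
    Set.indicator_union_of_disjoint (Set.disjoint_singleton_right.2 h)]
  rw [ENNReal.tsum_add, Measure.dirac_apply' _ hA]
  congr 1
  rw [tsum_eq_single x]
  · simp
  · intro y hy; simp [hy]

end Basic

section Measurability

variable {X : Type*} [MetricSpace X] [SigmaCompactSpace X] [MeasurableSpace X] [BorelSpace X]

theorem measurable_toMeasure : Measurable (toMeasure : Configuration X → Measure X) :=
  comap_measurable _

theorem measurable_count {A : Set X} (hA : MeasurableSet A) :
    Measurable fun ω : Configuration X => ω.toMeasure A :=
  (Measure.measurable_coe hA).comp measurable_toMeasure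

theorem measurable_of_count {Z : Type*} [MeasurableSpace Z] {f : Z → Configuration X}
    (hf : ∀ A : Set X, MeasurableSet A → Measurable fun z => (f z).toMeasure A) :
    Measurable f := by
  rw [measurable_comap_iff]
  exact Measure.measurable_of_measurable_coe _ hf

/-- The kernel `ω ↦ ω(dx)`. -/
def countKernel (X : Type*) [MetricSpace X] [SigmaCompactSpace X] [MeasurableSpace X]
    [BorelSpace X] : Kernel (Configuration X) X where
  toFun := toMeasure
  measurable' := measurable_toMeasure

@[simp]
theorem countKernel_apply (ω : Configuration X) : countKernel X ω = ω.toMeasure := rfl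

/-- The masses `ω(K)` are finite but not uniformly bounded in `ω`, so the restricted kernel need not
be a finite kernel. Normalising it gives mass at most one, and the finite density `ω(K)` restores
it. -/
theorem isSFiniteKernel_restrict {K : Set X} (hK : MeasurableSet K)
    (hfin : ∀ ω : Configuration X, ω.toMeasure K < ∞) :
    IsSFiniteKernel ((countKernel X).restrict hK) := by
  let κ : Kernel (Configuration X) X :=
    { toFun := fun ω => (ω.toMeasure K)⁻¹ • ω.toMeasure.restrict K
      measurable' := Measure.measurable_of_measurable_coe _ fun A hA => by
        simp only [Measure.smul_apply, Measure.restrict_apply hA, smul_eq_mul]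
        exact (measurable_count hK).inv.mul (measurable_count (hA.inter hK)) }
  have hκ (ω : Configuration X) : κ ω = (ω.toMeasure K)⁻¹ • ω.toMeasure.restrict K := rfl
  have : IsFiniteKernel κ := ⟨⟨1, ENNReal.one_lt_top, fun ω => by
    simp only [hκ, Measure.smul_apply, Measure.restrict_apply_univ, smul_eq_mul]
    exact ENNReal.inv_mul_le_one _⟩⟩
  have key : (countKernel X).restrict hK = κ.withDensity fun ω _ => ω.toMeasure K := by
    ext1 ω
    have hm : Measurable (Function.uncurry fun (ω : Configuration X) (_ : X) => ω.toMeasure K) :=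
      (measurable_count hK).comp measurable_fst
    rw [Kernel.withDensity_apply _ hm,
      Kernel.restrict_apply, countKernel_apply, withDensity_const, hκ, smul_smul]
    rcases eq_or_ne (ω.toMeasure K) 0 with h | h
    · rw [Measure.restrict_eq_zero.2 h, smul_zero]
    · rw [ENNReal.mul_inv_cancel h (hfin ω).ne, one_smul]
  rw [key]
  exact Kernel.IsSFiniteKernel.withDensity _ fun ω _ => (hfin ω).ne

instance : IsSFiniteKernel (countKernel X) := by
  have hm (n : ℕ) : MeasurableSet (disjointed (compactCovering X) n) :=
    MeasurableSet.disjointed (fun n => (isCompact_compactCovering X n).measurableSet) n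
  have h : countKernel X = Kernel.sum fun n => (countKernel X).restrict (hm n) := by
    ext1 ω
    rw [Kernel.sum_apply]
    simp only [Kernel.restrict_apply]
    rw [← Measure.restrict_iUnion (disjoint_disjointed _) hm, iUnion_disjointed,
      iUnion_compactCovering, Measure.restrict_univ]
  have (n : ℕ) : IsSFiniteKernel ((countKernel X).restrict (hm n)) :=
    isSFiniteKernel_restrict _ fun ω => (measure_mono (disjointed_subset _ _)).trans_lt
      (ω.toMeasure_lt_top (isCompact_compactCovering X n)
        (isCompact_compactCovering X n).measurableSet)
  rw [h]
  infer_instance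

theorem measurable_count_diff {A : Set X} (hA : MeasurableSet A) :
    Measurable fun z : Configuration X × X => z.1.toMeasure (A ∩ {z.2}ᶜ) := by
  have hs : MeasurableSet {z : (Configuration X × X) × X | z.2 ∈ A ∧ z.2 ≠ z.1.2} :=
    (measurable_snd hA).inter
      (measurableSet_eq_fun measurable_snd measurable_fst.snd).compl
  have := Kernel.measurable_kernel_prodMk_left (κ := (countKernel X).prodMkRight X) hs
  simpa only [Kernel.prodMkRight_apply, countKernel_apply] using! this

theorem measurable_erase : Measurable fun z : Configuration X × X => z.1.erase z.2 := by
  refine measurable_of_count fun A hA => ?_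
  simp only [toMeasure_erase, Measure.restrict_apply hA]
  exact measurable_count_diff hA

theorem measurable_insert : Measurable fun z : Configuration X × X => z.1.insert z.2 := by
  refine measurable_of_count fun A hA => ?_
  have h (z : Configuration X × X) : (z.1.insert z.2).toMeasure A =
      z.1.toMeasure (A ∩ {z.2}ᶜ) + A.indicator 1 z.2 := by
    -- Erasing the point beforehand guarantees that the insertion adds exactly one Dirac mass,
    -- whether or not the point was present.
    rw [← insert_erase, toMeasure_insert (by simp [erase]), toMeasure_erase, Measure.add_apply,
      Measure.restrict_apply hA, Measure.dirac_apply' _ hA]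
  simp only [h]
  exact (measurable_count_diff hA).add ((measurable_one.indicator hA).comp measurable_snd)

theorem _root_.Measurable.configuration_insert {Z : Type*} [MeasurableSpace Z]
    {f : Z → Configuration X} {g : Z → X} (hf : Measurable f) (hg : Measurable g) :
    Measurable fun z => (f z).insert (g z) :=
  measurable_insert.comp (hf.prodMk hg)

theorem _root_.Measurable.configuration_erase {Z : Type*} [MeasurableSpace Z]
    {f : Z → Configuration X} {g : Z → X} (hf : Measurable f) (hg : Measurable g) :
    Measurable fun z => (f z).erase (g z) :=
  measurable_erase.comp (hf.prodMk hg)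

theorem ae_notMem_carrier (σ : Measure X) [NullSingletonClass σ] (ω : Configuration X) :
    ∀ᵐ x ∂σ, x ∉ ω.carrier :=
  ω.countable_carrier.ae_notMem σ

end Measurability

end Configuration

end

/-! ### From Poisson counts to size-biasing identities. -/

section

/-- The size-bias property of the Poisson law, the one-dimensional germ of the Mecke formula: the
weight of `k + 1` times `k + 1` is `r` times the weight of `k`. -/
theorem lintegral_map_cast_poissonMeasure_mul (r : ℝ≥0) {f : ℝ≥0∞ → ℝ≥0∞} (hf : Measurable f) :
    ∫⁻ x, f x * x ∂((poissonMeasure r).map (fun k : ℕ => (k : ℝ≥0∞))) =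
      r * ∫⁻ x, f (x + 1) ∂((poissonMeasure r).map (fun k : ℕ => (k : ℝ≥0∞))) := by
  have hf₁ : Measurable fun x => f x * x := hf.mul measurable_id
  have hf₂ : Measurable fun x => f (x + 1) := hf.comp (measurable_id.add_const 1)
  rw [lintegral_map hf₁ .of_discrete, lintegral_map hf₂ .of_discrete, poissonMeasure]
  simp only [lintegral_sum_measure, lintegral_smul_measure, lintegral_dirac, smul_eq_mul]
  rw [tsum_eq_zero_add' ENNReal.summable, ← ENNReal.tsum_mul_left]
  simp only [Nat.cast_zero, mul_zero, zero_add]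
  refine tsum_congr fun k => ?_
  have h : ENNReal.ofReal (Real.exp (-r) * r ^ (k + 1) / (k + 1)!) * ((k + 1 : ℕ) : ℝ≥0∞) =
      r * ENNReal.ofReal (Real.exp (-r) * r ^ k / k !) := by
    rw [← ENNReal.ofReal_natCast, ← ENNReal.ofReal_coe_nnreal,
      ← ENNReal.ofReal_mul (by positivity), ← ENNReal.ofReal_mul (by positivity)]
    congr 1
    rw [Nat.factorial_succ]
    push_cast
    field_simp
    ring
  push_cast at h ⊢
  rw [← mul_assoc (r : ℝ≥0∞), ← h]
  ring

namespace IsPoisson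

variable {X : Type*} [MetricSpace X] [SigmaCompactSpace X] [MeasurableSpace X] [BorelSpace X]
  {σ : Measure X} {π : Measure (Configuration X)}

open PoissonInvariance.Configuration

theorem iIndepFun_count' (hπ : IsPoisson σ π) {τ : Type*} [Fintype τ] {A : τ → Set X}
    (hA : ∀ i, MeasurableSet (A i)) (hfin : ∀ i, σ (A i) < ∞)
    (hd : Pairwise fun i j => Disjoint (A i) (A j)) :
    iIndepFun (fun i ω => toMeasure ω (A i)) π := by
  have e := Fintype.equivFin τ
  have := hπ.iIndepFun_count _ (fun i => A (e.symm i)) (fun i => hA _) (fun i => hfin _)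
    (fun i j hij => hd (e.symm.injective.ne hij))
  have := this.precomp e.injective
  simpa [Function.comp_def] using! this

theorem lintegral_count (hπ : IsPoisson σ π) {A : Set X} (hA : MeasurableSet A) (hfin : σ A < ∞)
    {f : ℝ≥0∞ → ℝ≥0∞} (hf : Measurable f) :
    ∫⁻ ω, f (ω.toMeasure A) * ω.toMeasure A ∂π = σ A * ∫⁻ ω, f (ω.toMeasure A + 1) ∂π := by
  have h1 := lintegral_map (μ := π) (hf.mul measurable_id) (measurable_count hA)
  have h2 := lintegral_map (μ := π) (hf.comp (measurable_id.add_const 1)) (measurable_count hA)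
  simp only [Pi.mul_apply, id, Function.comp_apply] at h1 h2
  rw [← h1, ← h2, hπ.map_count A hA hfin, lintegral_map_cast_poissonMeasure_mul _ hf,
    ENNReal.coe_toNNReal hfin.ne]

theorem ae_notMem_carrier (hπ : IsPoisson σ π) [NullSingletonClass σ] (x : X) :
    ∀ᵐ ω ∂π, x ∉ ω.carrier := by
  have h0 : σ {x} = 0 := measure_singleton x
  have hm := measurableSet_singleton x
  have h : ∫⁻ ω, toMeasure ω {x} ∂π = 0 := by
    simpa [h0] using hπ.lintegral_count hm (by simp [h0]) (f := fun _ => 1) measurable_const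
  rw [lintegral_eq_zero_iff (measurable_count hm)] at h
  filter_upwards [h] with ω hω hx
  rw [Pi.zero_apply, toMeasure_apply _ hm, ENNReal.tsum_eq_zero] at hω
  simpa [hx] using hω x

theorem lintegral_prod_count (hπ : IsPoisson σ π) {τ : Type*} [Fintype τ] [DecidableEq τ]
    {A : τ → Set X} (hA : ∀ i, MeasurableSet (A i)) (hfin : ∀ i, σ (A i) < ∞)
    (hd : Pairwise fun i j => Disjoint (A i) (A j)) {f : τ → ℝ≥0∞ → ℝ≥0∞}
    (hf : ∀ i, Measurable (f i)) (i₀ : τ) :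
    ∫⁻ ω, (∏ i, f i (ω.toMeasure (A i))) * ω.toMeasure (A i₀) ∂π =
      σ (A i₀) * ∫⁻ ω, ∏ i, f i (ω.toMeasure (A i) + (Pi.single i₀ 1 : τ → ℝ≥0∞) i) ∂π := by
  have hI := hπ.iIndepFun_count' hA hfin hd
  have e1 : ∀ ω : Configuration X, (∏ i, f i (ω.toMeasure (A i))) * ω.toMeasure (A i₀) =
      ∏ i, (fun i x => f i x * if i = i₀ then x else 1) i (ω.toMeasure (A i)) := by
    intro ω
    rw [Finset.prod_mul_distrib, Fintype.prod_ite_eq']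
  have m1 : ∀ i, Measurable ((fun i x => f i x * if i = i₀ then x else 1) i) := by
    intro i
    by_cases h : i = i₀
    · simpa [h] using! (hf _).mul measurable_id
    · simpa [h] using hf _
  have m2 : ∀ i, Measurable ((fun i x => f i (x + (Pi.single i₀ 1 : τ → ℝ≥0∞) i)) i) :=
    fun i => (hf i).comp (measurable_id.add_const _)
  simp_rw [e1]
  have l1 := lintegral_prod_eq_prod_lintegral_of_indepFun Finset.univ _ (hI.comp _ m1)
    fun i => (m1 i).comp (measurable_count (hA i))
  have l2 := lintegral_prod_eq_prod_lintegral_of_indepFun Finset.univ _ (hI.comp _ m2)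
    fun i => (m2 i).comp (measurable_count (hA i))
  simp only [Function.comp_apply] at l1 l2
  rw [l1, l2, ← Finset.mul_prod_erase _ _ (Finset.mem_univ i₀),
    ← Finset.mul_prod_erase _ _ (Finset.mem_univ i₀), ← mul_assoc]
  congr 1
  · simpa using hπ.lintegral_count (hA i₀) (hfin i₀) (hf i₀)
  · refine Finset.prod_congr rfl fun i hi => ?_
    simp [Finset.ne_of_mem_erase hi]

/-- For functions of product form this follows from independence and `lintegral_prod_count`.
Rectangles determine finite measures on the product, which gives general `g`. -/
theorem lintegral_vector_count (hπ : IsPoisson σ π) {τ : Type*} [Fintype τ] [DecidableEq τ]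
    {A : τ → Set X} (hA : ∀ i, MeasurableSet (A i)) (hfin : ∀ i, σ (A i) < ∞)
    (hd : Pairwise fun i j => Disjoint (A i) (A j)) {g : (τ → ℝ≥0∞) → ℝ≥0∞}
    (hg : Measurable g) (i₀ : τ) :
    ∫⁻ ω, g (fun i => ω.toMeasure (A i)) * ω.toMeasure (A i₀) ∂π =
      σ (A i₀) * ∫⁻ ω, g ((fun i => ω.toMeasure (A i)) + Pi.single i₀ 1) ∂π := by
  have := hπ.isProbabilityMeasure
  have hN : Measurable fun (ω : Configuration X) i => ω.toMeasure (A i) :=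
    measurable_pi_lambda _ fun i => measurable_count (hA i)
  have hN' : Measurable fun (ω : Configuration X) =>
      (fun i => ω.toMeasure (A i)) + (Pi.single i₀ 1 : τ → ℝ≥0∞) :=
    hN.add_const _
  have hdens := measurable_count (X := X) (hA i₀)
  have key : (π.withDensity fun ω => ω.toMeasure (A i₀)).map (fun ω i => ω.toMeasure (A i)) =
      σ (A i₀) • π.map fun ω => (fun i => ω.toMeasure (A i)) + Pi.single i₀ 1 := by
    have hrect : ∀ U : τ → Set ℝ≥0∞, (∀ i, MeasurableSet (U i)) →
        (π.withDensity fun ω => ω.toMeasure (A i₀)).map (fun ω i => ω.toMeasure (A i))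
          (Set.univ.pi U) =
        (σ (A i₀) • π.map fun ω => (fun i => ω.toMeasure (A i)) + Pi.single i₀ 1)
          (Set.univ.pi U) := by
      intro U hU
      have hpi : MeasurableSet (Set.univ.pi U) := .univ_pi hU
      have hprod := hπ.lintegral_prod_count hA hfin hd
        (f := fun i => (U i).indicator 1) (fun i => measurable_one.indicator (hU i)) i₀
      have hind : ∀ y : τ → ℝ≥0∞, ∏ i, (U i).indicator (1 : ℝ≥0∞ → ℝ≥0∞) (y i) =
          (Set.univ.pi U).indicator 1 y := by
        intro y
        by_cases hy : y ∈ Set.univ.pi U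
        · rw [Set.indicator_of_mem hy, Pi.one_apply]
          exact Finset.prod_eq_one fun i _ => Set.indicator_of_mem (hy i trivial) _
        · rw [Set.indicator_of_notMem hy]
          simp only [Set.mem_pi, Set.mem_univ, true_imp_iff, not_forall] at hy
          obtain ⟨i, hi⟩ := hy
          exact Finset.prod_eq_zero (Finset.mem_univ i) (Set.indicator_of_notMem hi _)
      rw [Measure.map_apply hN hpi, withDensity_apply _ (hN hpi), Measure.smul_apply,
        ← lintegral_indicator_one hpi, lintegral_map (measurable_one.indicator hpi) hN',
        ← lintegral_indicator (hN hpi), smul_eq_mul]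
      simp only [← hind, Pi.add_apply]
      rw [← hprod]
      refine lintegral_congr fun ω => ?_
      rw [hind fun i => ω.toMeasure (A i)]
      by_cases h : (fun i => ω.toMeasure (A i)) ∈ Set.univ.pi U <;>
        simp only [Set.indicator, h, Set.mem_preimage, if_true, if_false, Pi.one_apply, one_mul,
          zero_mul]
    have : IsFiniteMeasure
        ((π.withDensity fun ω => ω.toMeasure (A i₀)).map (fun ω i => ω.toMeasure (A i))) := by
      constructor
      rw [← Set.pi_univ, hrect _ fun _ => .univ]
      simp only [Measure.smul_apply, smul_eq_mul]
      have := Measure.isProbabilityMeasure_map (μ := π) hN'.aemeasurable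
      exact ENNReal.mul_lt_top (hfin i₀) (measure_lt_top _ _)
    refine ext_of_generate_finite _ generateFrom_pi.symm isPiSystem_pi ?_ ?_
    · rintro _ ⟨U, hU, rfl⟩
      exact hrect U fun i => hU i trivial
    · simpa using hrect (fun _ => Set.univ) fun _ => .univ
  calc _ = ∫⁻ y, g y ∂((π.withDensity fun ω => ω.toMeasure (A i₀)).map
        (fun ω i => ω.toMeasure (A i))) := by
        have := lintegral_withDensity_eq_lintegral_mul π hdens (hg.comp hN)
        simp only [Function.comp_apply, Pi.mul_apply] at this
        rw [lintegral_map hg hN, this]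
        simp only [mul_comm]
    _ = _ := by
        rw [key, lintegral_smul_measure, lintegral_map hg hN', smul_eq_mul]

/-- The sets may overlap, so they are cut into the atoms of the algebra they generate. The counts of
the `B i` are sums of atom counts, and a point added in one atom raises the count of that atom
alone. -/
theorem lintegral_family_count (hπ : IsPoisson σ π) [NullSingletonClass σ] {ι : Type*} [Finite ι]
    {B : ι → Set X} (hB : ∀ i, MeasurableSet (B i)) (hfin : ∀ i, σ (B i) < ∞)
    {U : Set (ι → ℝ≥0∞)} (hU : MeasurableSet U) (i₀ : ι) :
    ∫⁻ ω in {ω : Configuration X | (fun i => ω.toMeasure (B i)) ∈ U}, ω.toMeasure (B i₀) ∂π =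
      ∫⁻ x in B i₀, π {ω | (fun i => (ω.insert x).toMeasure (B i)) ∈ U} ∂σ := by
  classical
  have := Fintype.ofFinite ι
  -- `T` records which of the `B i` contain the point. Intersecting with the union empties the atom
  -- outside all `B i`, which could have infinite measure.
  let A : (ι → Prop) → Set X := fun T => {x | x ∈ ⋃ i, B i} ∩ ⋂ i, {x | x ∈ B i ↔ T i}
  have hA : ∀ T, MeasurableSet (A T) := fun T => by
    refine (MeasurableSet.iUnion hB).inter (MeasurableSet.iInter fun i => ?_)
    by_cases h : T i
    · simpa only [h, iff_true] using! hB i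
    · simpa only [h, iff_false] using! (hB i).compl
  have hAfin : ∀ T, σ (A T) < ∞ := fun T => by
    refine (measure_mono Set.inter_subset_left).trans_lt ?_
    exact (measure_iUnion_le _).trans_lt (by
      rw [tsum_fintype]; exact ENNReal.sum_lt_top.2 fun i _ => hfin i)
  have hAd : Pairwise fun S T => Disjoint (A S) (A T) := by
    intro S T hST
    rw [Set.disjoint_left]
    intro x hx hy
    simp only [A, Set.mem_inter_iff, Set.mem_iInter, Set.mem_ofPred_eq] at hx hy
    exact hST (funext fun i => propext ((hx.2 i).symm.trans (hy.2 i)))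
  have hBA : ∀ i, B i = ⋃ T ∈ Finset.univ.filter (fun T : ι → Prop => T i), A T := by
    intro i
    ext x
    simp only [Finset.mem_filter, Finset.mem_univ, true_and, Set.mem_iUnion, exists_prop, A,
      Set.mem_inter_iff, Set.mem_iInter, Set.mem_ofPred_eq]
    constructor
    · exact fun h => ⟨fun j => x ∈ B j, h, ⟨i, h⟩, fun j => Iff.rfl⟩
    · rintro ⟨T, hT, -, h⟩
      exact (h i).2 hT
  have hsum : ∀ (ρ : Measure X) i,
      ρ (B i) = ∑ T ∈ Finset.univ.filter (fun T : ι → Prop => T i), ρ (A T) := by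
    intro ρ i
    rw [hBA i, measure_biUnion_finset (fun S _ T _ h => hAd h) fun T _ => hA T]
  let ψ : ((ι → Prop) → ℝ≥0∞) → ι → ℝ≥0∞ := fun y i =>
    ∑ T ∈ Finset.univ.filter (fun T : ι → Prop => T i), y T
  have hψ : Measurable ψ := measurable_pi_lambda _ fun i =>
    Finset.measurable_fun_sum _ fun T _ => measurable_pi_apply T
  have hψB : ∀ ω : Configuration X,
      (fun i => ω.toMeasure (B i)) = ψ fun T => ω.toMeasure (A T) := fun ω =>
    funext fun i => hsum _ i
  have hmU : MeasurableSet {ω : Configuration X | (fun i => ω.toMeasure (B i)) ∈ U} :=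
    (measurable_pi_lambda _ fun i => measurable_count (hB i)) hU
  let g : ((ι → Prop) → ℝ≥0∞) → ℝ≥0∞ := (ψ ⁻¹' U).indicator 1
  have hg : Measurable g := measurable_one.indicator (hψ hU)
  have hgω : ∀ (ω : Configuration X), g (fun T => ω.toMeasure (A T)) =
      {ω : Configuration X | (fun i => ω.toMeasure (B i)) ∈ U}.indicator 1 ω := by
    intro ω
    simp only [g, Set.indicator, Set.mem_preimage, Set.mem_ofPred_eq, hψB ω, Pi.one_apply]
  have hL : ∫⁻ ω in {ω : Configuration X | (fun i => ω.toMeasure (B i)) ∈ U},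
      ω.toMeasure (B i₀) ∂π = ∑ T ∈ Finset.univ.filter (fun T : ι → Prop => T i₀),
        ∫⁻ ω, g (fun T => ω.toMeasure (A T)) * ω.toMeasure (A T) ∂π := by
    rw [← lintegral_indicator hmU, ← lintegral_finsetSum]
    · refine lintegral_congr fun ω => ?_
      rw [← Finset.mul_sum, ← hsum, hgω]
      simp only [Set.indicator, Pi.one_apply]
      split_ifs <;> simp
    · intro T _
      exact (hg.comp (measurable_pi_lambda _ fun T => measurable_count (hA T))).mul
        (measurable_count (hA T))
  have hins : ∀ T, ∀ x ∈ A T, π {ω | (fun i => (ω.insert x).toMeasure (B i)) ∈ U} =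
      ∫⁻ ω, g ((fun T => ω.toMeasure (A T)) + Pi.single T 1) ∂π := by
    intro T x hx
    have hm : MeasurableSet {ω : Configuration X |
        (fun i => (ω.insert x).toMeasure (B i)) ∈ U} :=
      (measurable_id.configuration_insert measurable_const) hmU
    rw [← lintegral_indicator_one hm]
    refine lintegral_congr_ae ?_
    filter_upwards [hπ.ae_notMem_carrier x] with ω hω
    have : (fun T => ω.toMeasure (A T)) + Pi.single T 1 =
        fun S => (ω.insert x).toMeasure (A S) := by
      funext S
      rw [toMeasure_insert hω, Measure.add_apply, Measure.dirac_apply' _ (hA S), Pi.add_apply]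
      congr 1
      by_cases h : S = T
      · subst h; simp [hx]
      · rw [Pi.single_eq_of_ne h, Set.indicator_of_notMem]
        exact fun hS => Set.disjoint_left.1 (hAd h) hS hx
    rw [this, hgω]
    rfl
  rw [hL, hBA i₀, lintegral_biUnion_finset (fun S _ T _ h => hAd h) fun T _ => hA T]
  refine Finset.sum_congr rfl fun T _ => ?_
  rw [setLIntegral_congr_fun (hA T) (hins T), setLIntegral_const, mul_comm,
    ← hπ.lintegral_vector_count hA hAfin hAd hg T]

end IsPoisson

end

/-! ### The Mecke formula. -/

section

namespace IsPoisson

variable {X : Type*} [MetricSpace X] [SigmaCompactSpace X] [MeasurableSpace X] [BorelSpace X]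
  {σ : Measure X} {π : Measure (Configuration X)}

open PoissonInvariance.Configuration

/-- The Poisson property speaks only of sets of finite measure; every count is a supremum of such
counts because `σ` is σ-finite. -/
theorem measurableSpace_configuration_le (σ : Measure X) [SigmaFinite σ]
    (m : MeasurableSpace (Configuration X))
    (h : ∀ B : Set X, MeasurableSet B → σ B < ∞ →
      Measurable[m] fun ω : Configuration X => ω.toMeasure B) :
    MeasurableSpace.comap toMeasure inferInstance ≤ m := by
  have h' : ∀ B : Set X, MeasurableSet B →
      Measurable[m] fun ω : Configuration X => ω.toMeasure B := by
    intro B hB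
    have : (fun ω : Configuration X => ω.toMeasure B) =
        fun ω => ⨆ n, ω.toMeasure (B ∩ spanningSets σ n) := by
      funext ω
      rw [← Monotone.measure_iUnion, ← Set.inter_iUnion, iUnion_spanningSets, Set.inter_univ]
      exact fun i j hij => Set.inter_subset_inter_right _ (monotone_spanningSets σ hij)
    rw [this]
    refine Measurable.iSup fun n => h _ (hB.inter (measurableSet_spanningSets σ n)) ?_
    exact (measure_mono Set.inter_subset_right).trans_lt (measure_spanningSets_lt_top σ n)
  have : Measurable[m] (toMeasure : Configuration X → Measure X) :=
    Measure.measurable_of_measurable_coe _ h'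
  exact this.comap_le

variable [SigmaFinite σ] [NullSingletonClass σ]

/-- Both sides are finite measures of mass `σ C`. They agree on the π-system of events that
constrain finitely many counts, where `lintegral_family_count` applies. -/
theorem withDensity_count (hπ : IsPoisson σ π) {C : Set X} (hC : MeasurableSet C)
    (hfin : σ C < ∞) :
    π.withDensity (fun ω => ω.toMeasure C) =
      (π.prod (σ.restrict C)).map fun z => z.1.insert z.2 := by
  classical
  have := hπ.isProbabilityMeasure
  let ι := {B : Set X // MeasurableSet B ∧ σ B < ∞}
  let m : ι → MeasurableSpace (Configuration X) := fun B =>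
    MeasurableSpace.comap (fun ω => ω.toMeasure B.1) inferInstance
  have hgen : (inferInstance : MeasurableSpace (Configuration X)) =
      MeasurableSpace.generateFrom
        (piiUnionInter (fun n => {s | MeasurableSet[m n] s}) Set.univ) := by
    refine Eq.trans ?_ (generateFrom_piiUnionInter_measurableSet m Set.univ).symm
    refine le_antisymm (measurableSpace_configuration_le σ _ fun B hB hBf => ?_) ?_
    · have h1 : m ⟨B, hB, hBf⟩ ≤ ⨆ i ∈ Set.univ, m i :=
        le_iSup₂_of_le ⟨B, hB, hBf⟩ trivial le_rfl
      exact (comap_measurable _).mono h1 le_rfl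
    · exact iSup₂_le fun B _ => (measurable_count B.2.1).comap_le
  have key : ∀ s ∈ piiUnionInter (fun n => {s | MeasurableSet[m n] s}) Set.univ,
      π.withDensity (fun ω => ω.toMeasure C) s =
        (π.prod (σ.restrict C)).map (fun z => z.1.insert z.2) s := by
    rintro _ ⟨t, -, f, hf, rfl⟩
    have : ∀ B : t, ∃ U : Set ℝ≥0∞, MeasurableSet U ∧
        (fun ω : Configuration X => ω.toMeasure B.1.1) ⁻¹' U = f B := fun B => hf B B.2
    choose U hU hUf using this
    -- The set `C` joins the family as the index `none`; its own count is left unconstrained.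
    let B' : Option t → Set X := fun i => i.elim C fun B => B.1.1
    let V : Set (Option t → ℝ≥0∞) := {y | ∀ B : t, y (some B) ∈ U B}
    have hV : MeasurableSet V :=
      measurableSet_setOfPred.2 (Measurable.forall fun B =>
        measurableSet_setOfPred.1 ((measurable_pi_apply (some B)) (hU B)))
    have hs : (⋂ x ∈ t, f x) =
        {ω : Configuration X | (fun i => ω.toMeasure (B' i)) ∈ V} := by
      ext ω
      simp only [Set.mem_iInter, V, Set.mem_ofPred_eq, B', Option.elim]
      refine ⟨fun h B => ?_, fun h x hx => ?_⟩
      · have := h B B.2; rwa [← hUf B] at this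
      · rw [← hUf ⟨x, hx⟩]; exact h ⟨x, hx⟩
    have hB' : ∀ i, MeasurableSet (B' i) := by
      rintro (_ | B)
      · exact hC
      · exact B.1.2.1
    have hm : MeasurableSet {ω : Configuration X | (fun i => ω.toMeasure (B' i)) ∈ V} :=
      (measurable_pi_lambda _ fun i => measurable_count (hB' i)) hV
    rw [hs, withDensity_apply _ hm, Measure.map_apply measurable_insert hm,
      Measure.prod_apply_symm (measurable_insert hm)]
    refine hπ.lintegral_family_count (B := B') hB' ?_ hV none
    rintro (_ | B)
    · exact hfin
    · exact B.1.2.2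
  have hu : π.withDensity (fun ω => ω.toMeasure C) Set.univ = σ C := by
    rw [withDensity_apply _ .univ, Measure.restrict_univ]
    simpa using hπ.lintegral_count hC hfin (f := fun _ => 1) measurable_const
  have : IsFiniteMeasure (π.withDensity fun ω => ω.toMeasure C) := ⟨hu ▸ hfin⟩
  refine ext_of_generate_finite _ hgen (isPiSystem_piiUnionInter _
    (fun B => @MeasurableSpace.isPiSystem_measurableSet _ (m B)) _) key ?_
  rw [hu, Measure.map_apply measurable_insert .univ]
  rw [Set.preimage_univ, ← Set.univ_prod_univ, Measure.prod_prod, measure_univ, one_mul,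
    Measure.restrict_apply_univ]

/-- The Mecke formula, as an identity of measures. -/
theorem compProd_countKernel (hπ : IsPoisson σ π) :
    π.compProd (countKernel X) = (π.prod σ).map fun z => (z.1.insert z.2, z.2) := by
  have := hπ.isProbabilityMeasure
  have hins : Measurable fun z : Configuration X × X => (z.1.insert z.2, z.2) :=
    measurable_insert.prodMk measurable_snd
  have hrect : ∀ (E : Set (Configuration X)) (C : Set X), MeasurableSet E → MeasurableSet C →
      σ C < ∞ → π.compProd (countKernel X) (E ×ˢ C) =
        (π.prod σ).map (fun z => (z.1.insert z.2, z.2)) (E ×ˢ C) := by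
    intro E C hE hC hfin
    rw [Measure.compProd_apply_prod hE hC, Measure.map_apply hins (hE.prod hC)]
    have h := congrArg (fun ν => ν E) (hπ.withDensity_count hC hfin)
    simp only [withDensity_apply _ hE, Measure.map_apply measurable_insert hE] at h
    simp only [countKernel_apply]
    rw [h]
    have h2 : (fun z : Configuration X × X => (z.1.insert z.2, z.2)) ⁻¹' E ×ˢ C =
        (fun z : Configuration X × X => z.1.insert z.2) ⁻¹' E ∩ Set.univ ×ˢ C := by
      ext z; simp
    rw [h2, ← Measure.restrict_apply (measurable_insert hE), ← Measure.prod_restrict,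
      Measure.restrict_univ]
  refine Measure.ext_of_iUnion_eq_univ
    (s := fun n => (Set.univ : Set (Configuration X)) ×ˢ spanningSets σ n) ?_ fun n => ?_
  · rw [← Set.prod_iUnion, iUnion_spanningSets, Set.univ_prod_univ]
  · have hn := measurableSet_spanningSets σ n
    have hf : IsFiniteMeasure ((π.compProd (countKernel X)).restrict
        (Set.univ ×ˢ spanningSets σ n)) := by
      constructor
      rw [Measure.restrict_apply_univ, hrect _ _ .univ hn (measure_spanningSets_lt_top σ n),
        Measure.map_apply hins (MeasurableSet.univ.prod hn)]
      have : (fun z : Configuration X × X => (z.1.insert z.2, z.2)) ⁻¹'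
          Set.univ ×ˢ spanningSets σ n = Set.univ ×ˢ spanningSets σ n := by ext z; simp
      rw [this, Measure.prod_prod]
      simpa using measure_spanningSets_lt_top σ n
    refine Measure.ext_prod fun {E C} hE hC => ?_
    rw [Measure.restrict_apply (hE.prod hC), Measure.restrict_apply (hE.prod hC),
      Set.prod_inter_prod, Set.inter_univ]
    exact hrect _ _ hE (hC.inter hn)
      ((measure_mono Set.inter_subset_right).trans_lt (measure_spanningSets_lt_top σ n))

theorem lintegral_lintegral_toMeasure (hπ : IsPoisson σ π)
    {f : Configuration X × X → ℝ≥0∞} (hf : Measurable f) :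
    ∫⁻ ω, ∫⁻ t, f (ω, t) ∂ω.toMeasure ∂π = ∫⁻ ω, ∫⁻ t, f (ω.insert t, t) ∂σ ∂π := by
  have := hπ.isProbabilityMeasure
  have hins : Measurable fun z : Configuration X × X => (z.1.insert z.2, z.2) :=
    measurable_insert.prodMk measurable_snd
  have h := congrArg (fun ν => ∫⁻ z, f z ∂ν) hπ.compProd_countKernel
  simp only [lintegral_map hf hins] at h
  have hm : Measurable fun z : Configuration X × X => f (z.1.insert z.2, z.2) := hf.comp hins
  rw [Measure.lintegral_compProd hf, lintegral_prod _ hm.aemeasurable] at h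
  exact h

/-- The Mecke formula with a parameter. -/
theorem prod_compProd_countKernel (hπ : IsPoisson σ π) {S : Type*} [MeasurableSpace S]
    (ρ : Measure S) [SFinite ρ] :
    (π.prod ρ).compProd ((countKernel X).prodMkRight S) =
      ((π.prod ρ).prod σ).map fun z => ((z.1.1.insert z.2, z.1.2), z.2) := by
  have := hπ.isProbabilityMeasure
  have hins : Measurable fun z : (Configuration X × S) × X =>
      ((z.1.1.insert z.2, z.1.2), z.2) :=
    ((measurable_fst.fst.configuration_insert measurable_snd).prodMk
      measurable_fst.snd).prodMk measurable_snd
  refine Measure.ext_of_lintegral _ fun f hf => ?_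
  have hm : Measurable fun z : (Configuration X × S) × X => f ((z.1.1.insert z.2, z.1.2), z.2) :=
    hf.comp hins
  rw [Measure.lintegral_compProd hf, lintegral_map hf hins, lintegral_prod _ hm.aemeasurable,
    lintegral_prod_symm, lintegral_prod_symm]
  · refine lintegral_congr fun s => ?_
    have hfs : Measurable fun z : Configuration X × X => f ((z.1, s), z.2) :=
      hf.comp ((measurable_fst.prodMk measurable_const).prodMk measurable_snd)
    exact hπ.lintegral_lintegral_toMeasure hfs
  · exact hm.lintegral_prod_right'.aemeasurable
  · exact (hf.lintegral_kernel_prod_right' (κ := (countKernel X).prodMkRight S)).aemeasurable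

/-- Adding a `σ`-distributed point preserves almost sure properties. -/
theorem ae_insert (hπ : IsPoisson σ π) {p : Configuration X → Prop} (hp : ∀ᵐ ω ∂π, p ω) :
    ∀ᵐ z ∂π.prod σ, p (z.1.insert z.2) := by
  have := hπ.isProbabilityMeasure
  obtain ⟨E, hE, hEm, hE0⟩ := exists_measurable_superset_of_null (ae_iff.1 hp)
  have hins : Measurable fun z : Configuration X × X => (z.1.insert z.2, z.2) :=
    measurable_insert.prodMk measurable_snd
  -- By the Mecke formula this mass is the integral of `ω(X)` over the null set `E`.
  have h : (π.prod σ).map (fun z => (z.1.insert z.2, z.2)) (E ×ˢ Set.univ) = 0 := by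
    rw [← hπ.compProd_countKernel, Measure.compProd_apply_prod hEm .univ]
    exact setLIntegral_measure_zero _ _ hE0
  rw [Measure.map_apply hins (hEm.prod .univ)] at h
  rw [ae_iff]
  refine measure_mono_null (fun z hz => ?_) h
  simpa using hE hz

end IsPoisson

end

/-! ### Möbius inversion and the explicit form of `bigDelta`. -/

section

/-- A weighted Möbius inversion on finite sets. -/
theorem sum_powerset_inversion {ι R : Type*} [DecidableEq ι] [CommRing R] (h : ι → R)
    {f g : Finset ι → R} (U : Finset ι)
    (hf : ∀ S ⊆ U, f S = ∑ T ∈ S.powerset, (∏ i ∈ S \ T, -h i) * g T) :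
    g U = ∑ T ∈ U.powerset, (∏ i ∈ U \ T, h i) * f T := by
  have h1 : ∑ T ∈ U.powerset, (∏ i ∈ U \ T, h i) * f T =
      ∑ T ∈ U.powerset, ∑ V ∈ T.powerset,
        (∏ i ∈ U \ T, h i) * ((∏ i ∈ T \ V, -h i) * g V) := by
    refine Finset.sum_congr rfl fun T hT => ?_
    rw [hf T (Finset.mem_powerset.1 hT), Finset.mul_sum]
  have h2 : ∑ T ∈ U.powerset, ∑ V ∈ T.powerset,
        (∏ i ∈ U \ T, h i) * ((∏ i ∈ T \ V, -h i) * g V) =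
      ∑ V ∈ U.powerset, ∑ W ∈ (U \ V).powerset,
        (∏ i ∈ (U \ V) \ W, h i) * ((∏ i ∈ W, -h i) * g V) := by
    rw [Finset.sum_sigma', Finset.sum_sigma']
    refine Finset.sum_bij' (fun x _ => ⟨x.2, x.1 \ x.2⟩) (fun x _ => ⟨x.1 ∪ x.2, x.1⟩)
      ?_ ?_ ?_ ?_ ?_
    · rintro ⟨T, V⟩ h
      simp only [Finset.mem_sigma, Finset.mem_powerset] at h ⊢
      exact ⟨h.2.trans h.1, Finset.sdiff_subset_sdiff h.1 le_rfl⟩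
    · rintro ⟨V, W⟩ h
      simp only [Finset.mem_sigma, Finset.mem_powerset] at h ⊢
      exact ⟨Finset.union_subset h.1 (h.2.trans Finset.sdiff_subset), Finset.subset_union_left⟩
    · rintro ⟨T, V⟩ h
      simp only [Finset.mem_sigma, Finset.mem_powerset] at h ⊢
      rw [Finset.union_sdiff_of_subset h.2]
    · rintro ⟨V, W⟩ h
      simp only [Finset.mem_sigma, Finset.mem_powerset] at h ⊢
      rw [Finset.union_sdiff_cancel_left (Finset.disjoint_of_subset_right h.2
        Finset.disjoint_sdiff)]
    · rintro ⟨T, V⟩ h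
      simp only [Finset.mem_sigma, Finset.mem_powerset] at h ⊢
      have hE : (U \ V) \ (T \ V) = (U \ T) := by
        ext i
        have := @h.2 i
        simp only [Finset.mem_sdiff]
        tauto
      rw [hE]
  -- The inner sum is the expansion of `∏_{i ∈ U \ V} (-h i + h i)`, which vanishes unless `V = U`.
  have h3 : ∀ V ∈ U.powerset, ∑ W ∈ (U \ V).powerset,
      (∏ i ∈ (U \ V) \ W, h i) * ((∏ i ∈ W, -h i) * g V) = if V = U then g V else 0 := by
    intro V hV
    have : ∑ W ∈ (U \ V).powerset, (∏ i ∈ (U \ V) \ W, h i) * ((∏ i ∈ W, -h i) * g V) =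
        (∏ i ∈ U \ V, (-h i + h i)) * g V := by
      rw [Finset.prod_add, Finset.sum_mul]
      exact Finset.sum_congr rfl fun W _ => by ring
    rw [this]
    split_ifs with hVU
    · subst hVU; simp
    · obtain ⟨i, hi, hi'⟩ := Finset.exists_of_ssubset
        (Finset.ssubset_iff_subset_ne.2 ⟨Finset.mem_powerset.1 hV, hVU⟩)
      rw [Finset.prod_eq_zero (Finset.mem_sdiff.2 ⟨hi, hi'⟩) (by ring), zero_mul]
  rw [h1, h2, Finset.sum_congr rfl h3, Finset.sum_ite_eq' _ U]
  simp

theorem sum_powerset_inversion_one {ι R : Type*} [DecidableEq ι] [CommRing R]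
    {f g : Finset ι → R} (U : Finset ι)
    (hf : ∀ S ⊆ U, f S = ∑ T ∈ S.powerset, (∏ _i ∈ S \ T, (-1)) * g T) :
    g U = ∑ T ∈ U.powerset, f T := by
  simpa using sum_powerset_inversion (fun _ => 1) U hf

section AddPoints

variable {X : Type*} [TopologicalSpace X]

namespace Configuration

/-- The configuration `ω ∪ {s_i : i ∈ S}`. -/
def addPoints {ι : Type*} (ω : Configuration X) (s : ι → X) (S : Finset ι) : Configuration X where
  carrier := ω.carrier ∪ s '' S
  finite_inter_compact K hK := by
    rw [Set.union_inter_distrib_right]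
    exact (ω.finite_inter_compact K hK).union ((S.finite_toSet.image s).inter_of_left K)

variable {ι : Type*}

@[simp]
theorem addPoints_empty (ω : Configuration X) (s : ι → X) : ω.addPoints s ∅ = ω := by
  ext1; simp [addPoints]

theorem addPoints_insert [DecidableEq ι] (ω : Configuration X) (s : ι → X) (i : ι)
    (S : Finset ι) : ω.addPoints s (Insert.insert i S) = (ω.addPoints s S).insert (s i) := by
  ext1
  simp only [addPoints, insert, Finset.coe_insert, Set.image_insert_eq]
  rw [Set.union_assoc, Set.union_singleton]

theorem insert_addPoints [DecidableEq ι] (ω : Configuration X) (s : ι → X) (i : ι)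
    (S : Finset ι) : (ω.insert (s i)).addPoints s S = ω.addPoints s (Insert.insert i S) := by
  ext1
  simp only [addPoints, insert, Finset.coe_insert, Set.image_insert_eq]
  rw [Set.union_assoc, Set.singleton_union]

theorem addPoints_comp {κ : Type*} (ω : Configuration X) (s : ι → X) (e : κ ↪ ι)
    (S : Finset κ) : ω.addPoints (s ∘ e) S = ω.addPoints s (S.map e) := by
  ext1
  simp [addPoints, ← Set.image_comp]

end Configuration

/-- Inclusion-exclusion over indices rather than points, so it remains valid when some `s i`
coincide or already belong to `ω`. -/
theorem foldr_gradD {m : ℕ} (s : Fin m → X) (F : Configuration X → ℝ) (L : List (Fin m))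
    (hL : L.Nodup) (ω : Configuration X) :
    L.foldr (fun i G => gradD (s i) G) F ω =
      ∑ T ∈ L.toFinset.powerset, (∏ _i ∈ L.toFinset \ T, (-1 : ℝ)) * F (ω.addPoints s T) := by
  induction L generalizing ω with
  | nil => simp
  | cons i L ih =>
    obtain ⟨hi, hL⟩ := List.nodup_cons.1 hL
    have hi' : i ∉ L.toFinset := by simpa using hi
    rw [List.foldr_cons, gradD, ih hL, ih hL, List.toFinset_cons,
      Finset.sum_powerset_insert hi', sub_eq_neg_add, ← Finset.sum_neg_distrib]
    congr 1
    · refine Finset.sum_congr rfl fun T hT => ?_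
      have hiT : i ∉ T := fun h => hi' (Finset.mem_powerset.1 hT h)
      rw [Finset.insert_sdiff_of_notMem _ hiT, Finset.prod_insert (by simp [hi])]
      ring
    · refine Finset.sum_congr rfl fun T hT => ?_
      rw [Configuration.insert_addPoints, Finset.insert_sdiff_insert,
        Finset.sdiff_insert_of_notMem hi']

theorem gradSet_eq {m : ℕ} (s : Fin m → X) (S : Finset (Fin m)) (F : Configuration X → ℝ)
    (ω : Configuration X) :
    gradSet s S F ω =
      ∑ T ∈ S.powerset, (∏ _i ∈ S \ T, (-1 : ℝ)) * F (ω.addPoints s T) := by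
  rw [gradSet, foldr_gradD _ _ _ ((List.nodup_finRange m).filter _)]
  have : ((List.finRange m).filter (fun i => i ∈ S)).toFinset = S := by ext; simp
  rw [this]

theorem sum_gradSet {m : ℕ} (s : Fin m → X) (S : Finset (Fin m)) (F : Configuration X → ℝ)
    (ω : Configuration X) :
    ∑ T ∈ S.powerset, gradSet s T F ω = F (ω.addPoints s S) :=
  (sum_powerset_inversion_one (f := fun T => gradSet s T F ω)
    (g := fun T => F (ω.addPoints s T)) S fun T _ => gradSet_eq s T F ω).symm

/-- The product `∏_p v_p(s_p)(ω ∪ {s_i : i ∈ S, i ≠ p})`. -/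
def shiftProd {ι : Type*} [Fintype ι] [DecidableEq ι] (v : ι → Configuration X → X → ℝ)
    (S : Finset ι) (ω : Configuration X) (s : ι → X) : ℝ :=
  ∏ p, v p (ω.addPoints s (S.erase p)) (s p)

/-- Let `D S` be the sum defining `bigDelta`, with the union of the `Θ_p` prescribed to be `S`.
Expanding each factor of `shiftProd v S` in iterated gradients over the subsets of `S \ {p}` and
grouping by union gives `∑_{T ⊆ S} D T`, which is then inverted. -/
theorem bigDelta_eq {m : ℕ} (v : Fin m → Configuration X → X → ℝ) (s : Fin m → X)
    (ω : Configuration X) :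
    bigDelta v s ω =
      ∑ S : Finset (Fin m), (∏ _i ∈ Finset.univ \ S, (-1 : ℝ)) * shiftProd v S ω s := by
  classical
  let D : Finset (Fin m) → ℝ := fun S => ∑ Θ : Fin m → Finset (Fin m) with
      (Finset.univ.biUnion Θ = S ∧ ∀ p, p ∉ Θ p),
    ∏ p, gradSet s (Θ p) (fun η => v p η (s p)) ω
  have hD : bigDelta v s ω = D Finset.univ := by
    simp only [bigDelta, D]
  have key : ∀ S, shiftProd v S ω s = ∑ T ∈ S.powerset, (∏ i ∈ S \ T, -(-1 : ℝ)) * D T := by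
    intro S
    simp only [shiftProd, neg_neg, Finset.prod_const_one, one_mul]
    have h1 : ∀ p, v p (ω.addPoints s (S.erase p)) (s p) =
        ∑ T ∈ (S.erase p).powerset, gradSet s T (fun η => v p η (s p)) ω :=
      fun p => (sum_gradSet s (S.erase p) (fun η => v p η (s p)) ω).symm
    simp_rw [h1]
    rw [Finset.prod_univ_sum, ← Finset.sum_fiberwise_of_maps_to
      (g := fun Θ => Finset.univ.biUnion Θ) (t := S.powerset)]
    · refine Finset.sum_congr rfl fun T hT => Finset.sum_congr ?_ fun _ _ => rfl
      rw [Finset.mem_powerset] at hT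
      ext Θ
      simp only [Finset.mem_filter, Fintype.mem_piFinset, Finset.mem_powerset, Finset.mem_univ,
        true_and]
      constructor
      · rintro ⟨h, rfl⟩
        exact ⟨rfl, fun p hp => by simpa using h p hp⟩
      · rintro ⟨rfl, h⟩
        refine ⟨fun p i hi => Finset.mem_erase.2 ⟨?_, hT ?_⟩, rfl⟩
        · rintro rfl; exact h i hi
        · exact Finset.mem_biUnion.2 ⟨p, Finset.mem_univ _, hi⟩
    · intro Θ hΘ
      simp only [Fintype.mem_piFinset, Finset.mem_powerset] at hΘ
      exact Finset.mem_powerset.2 (Finset.biUnion_subset.2 fun p _ =>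
        (hΘ p).trans (Finset.erase_subset _ _))
  rw [hD, sum_powerset_inversion (fun _ => (-1 : ℝ)) Finset.univ fun S _ => key S,
    Finset.powerset_univ]

end AddPoints

end

/-! ### Positive isometries preserve signed moments. -/

section

/-- A positivity preserving isometry of `L¹` commutes with absolute values. -/
theorem map_abs_of_positive_isometry {X Y : Type*} [MeasurableSpace X] [MeasurableSpace Y]
    {μ : Measure Y} {σ : Measure X} {q : ℝ≥0∞} [Fact (1 ≤ q)] (hq : q = 1)
    (T : Lp ℝ q μ →ₗᵢ[ℝ] Lp ℝ q σ) (hT : ∀ f, 0 ≤ f → 0 ≤ T f) (f : Lp ℝ q μ) :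
    T |f| = |T f| := by
  subst hq
  have hle : |T f| ≤ T |f| := by
    refine abs_le'.2 ⟨?_, ?_⟩
    · have := hT (|f| - f) (sub_nonneg.2 (le_abs_self f))
      rwa [map_sub, sub_nonneg] at this
    · have := hT (|f| - -f) (sub_nonneg.2 (neg_le_abs f))
      rwa [map_sub, sub_nonneg, map_neg] at this
  -- Positivity alone gives `|T f| ≤ T |f|`; equal `L¹` norms force equality almost everywhere.
  have hnorm : ‖T |f|‖ = ‖|T f|‖ := by
    rw [norm_abs_eq_norm, T.norm_map, T.norm_map, norm_abs_eq_norm]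
  have h0 : 0 ≤ |T f| := abs_nonneg _
  have h1 : 0 ≤ T |f| := h0.trans hle
  rw [L1.norm_eq_integral_norm, L1.norm_eq_integral_norm] at hnorm
  have e0 : ∀ᵐ x ∂σ, 0 ≤ |T f| x := (Lp.coeFn_nonneg _).2 h0
  have e1 : ∀ᵐ x ∂σ, 0 ≤ T |f| x := (Lp.coeFn_nonneg _).2 h1
  have ele : ∀ᵐ x ∂σ, |T f| x ≤ T |f| x := (Lp.coeFn_le _ _).2 hle
  have i0 : ∫ x, ‖|T f| x‖ ∂σ = ∫ x, |T f| x ∂σ :=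
    integral_congr_ae (e0.mono fun x hx => Real.norm_of_nonneg hx)
  have i1 : ∫ x, ‖T |f| x‖ ∂σ = ∫ x, T |f| x ∂σ :=
    integral_congr_ae (e1.mono fun x hx => Real.norm_of_nonneg hx)
  rw [i0, i1] at hnorm
  have I0 : Integrable (fun x => (|T f| : Lp ℝ 1 σ) x) σ := L1.integrable_coeFn _
  have I1 : Integrable (T |f|) σ := L1.integrable_coeFn _
  have := (integral_eq_iff_of_ae_le I0 I1 ele).1 hnorm.symm
  exact (Lp.ext this).symm

section

variable {X : Type*} [TopologicalSpace X] [MeasurableSpace X] {σ : Measure X}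
  {Y : Type*} [MeasurableSpace Y] {μ : Measure Y} {N : ℕ}

theorem eLpNorm_natCast_add_one {Z : Type*} [MeasurableSpace Z] {ν : Measure Z} (f : Z → ℝ)
    (p : ℕ) : eLpNorm f ((p : ℝ≥0∞) + 1) ν ^ (p + 1) = ∫⁻ z, ‖f z‖ₑ ^ (p + 1) ∂ν := by
  have h := eLpNorm_nnreal_pow_eq_lintegral (f := f) (μ := ν) (p := (p : ℝ≥0) + 1)
    (by positivity)
  have e : (((p : ℝ≥0) + 1 : ℝ≥0) : ℝ) = ((p + 1 : ℕ) : ℝ) := by push_cast; rfl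
  have e' : (((p : ℝ≥0) + 1 : ℝ≥0) : ℝ≥0∞) = (p : ℝ≥0∞) + 1 := by push_cast; rfl
  simp only [e, e', ENNReal.rpow_natCast] at h
  exact h

theorem lintegral_pow_lt_top {h : Y → ℝ} (p : ℕ) (hh : MemLp h ((p : ℝ≥0∞) + 1) μ) :
    ∫⁻ y, ‖h y‖ₑ ^ (p + 1) ∂μ < ∞ := by
  rw [← eLpNorm_natCast_add_one]
  exact ENNReal.pow_lt_top hh.2

theorem RandomIsometry.lintegral_pow_eq (R : RandomIsometry N μ σ) (ω : Configuration X)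
    (p : Fin (N + 1)) {h : Y → ℝ} (hh : MemLp h (((p : ℕ) : ℝ≥0∞) + 1) μ) {v : X → ℝ}
    (hv : v =ᵐ[σ] R.toIsometry ω p (hh.toLp h)) :
    ∫⁻ x, ‖v x‖ₑ ^ ((p : ℕ) + 1) ∂σ = ∫⁻ y, ‖h y‖ₑ ^ ((p : ℕ) + 1) ∂μ := by
  rw [← eLpNorm_natCast_add_one, ← eLpNorm_natCast_add_one, eLpNorm_congr_ae hv,
    ← eLpNorm_congr_ae hh.coeFn_toLp, ← Lp.enorm_def, ← Lp.enorm_def]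
  congr 1
  rw [enorm_eq_nnnorm, enorm_eq_nnnorm, LinearIsometry.nnnorm_map]

/-- Isometry controls only `∫ |v|^p`, and odd signed moments need the positive and negative parts
separately. The positive part is `(|a| + a) / 2`; the identity is proved in `L¹`, where `R ω`
commutes with absolute values, and carried to the other exponents by `compatible`. -/
theorem RandomIsometry.posPart_ae_eq (R : RandomIsometry N μ σ) (ω : Configuration X)
    {h : Y → ℝ} (hh : ∀ p : Fin (N + 1), MemLp h (((p : ℕ) : ℝ≥0∞) + 1) μ) {v : X → ℝ}
    (hv : ∀ p : Fin (N + 1), v =ᵐ[σ] R.toIsometry ω p ((hh p).toLp h)) (p : Fin (N + 1)) :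
    (fun x => max (v x) 0) =ᵐ[σ] R.toIsometry ω p ((hh p).pos_part.toLp _) := by
  have hq : (((0 : Fin (N + 1)) : ℕ) : ℝ≥0∞) + 1 = 1 := by simp
  set f := (hh 0).toLp h with hf
  have hmax : ∀ a : ℝ, max a 0 = (1 / 2 : ℝ) * (|a| + a) := fun a => by
    rcases le_total 0 a with ha | ha
    · rw [max_eq_left ha, abs_of_nonneg ha]; ring
    · rw [max_eq_right ha, abs_of_nonpos ha]; ring
  have e1 : ⇑((hh p).pos_part.toLp _) =ᵐ[μ] ⇑((1 / 2 : ℝ) • (|f| + f)) := by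
    filter_upwards [(hh p).pos_part.coeFn_toLp, (hh 0).coeFn_toLp,
      Lp.coeFn_smul (1 / 2 : ℝ) (|f| + f), Lp.coeFn_add |f| f, Lp.coeFn_abs f]
      with y h1 h2 h3 h4 h5
    rw [h1, h3, Pi.smul_apply, h4, Pi.add_apply, h5, hf, h2, hmax, smul_eq_mul]
  refine Filter.EventuallyEq.symm ((R.compatible ω p 0 _ _ e1).trans ?_)
  have habs := map_abs_of_positive_isometry hq (R.toIsometry ω 0) (R.nonneg ω 0) f
  rw [map_smul, map_add, habs]
  filter_upwards [hv 0, Lp.coeFn_smul (1 / 2 : ℝ) (|R.toIsometry ω 0 f| + R.toIsometry ω 0 f),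
    Lp.coeFn_add |R.toIsometry ω 0 f| (R.toIsometry ω 0 f), Lp.coeFn_abs (R.toIsometry ω 0 f)]
    with x h1 h2 h3 h4
  rw [h2, Pi.smul_apply, h3, Pi.add_apply, h4, hmax, smul_eq_mul, h1]

theorem RandomIsometry.integral_posPart_pow (R : RandomIsometry N μ σ) (ω : Configuration X)
    {h : Y → ℝ} (hh : ∀ p : Fin (N + 1), MemLp h (((p : ℕ) : ℝ≥0∞) + 1) μ) {v : X → ℝ}
    (hv : ∀ p : Fin (N + 1), v =ᵐ[σ] R.toIsometry ω p ((hh p).toLp h)) (p : Fin (N + 1)) :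
    ∫ x, max (v x) 0 ^ ((p : ℕ) + 1) ∂σ = ∫ y, max (h y) 0 ^ ((p : ℕ) + 1) ∂μ := by
  have hvm : AEStronglyMeasurable v σ :=
    (Lp.aestronglyMeasurable _).congr (hv 0).symm
  have m₁ : AEStronglyMeasurable (fun x => max (v x) 0 ^ ((p : ℕ) + 1)) σ :=
    (hvm.sup aestronglyMeasurable_const).pow _
  have m₂ : AEStronglyMeasurable (fun y => max (h y) 0 ^ ((p : ℕ) + 1)) μ :=
    ((hh 0).1.sup aestronglyMeasurable_const).pow _
  rw [integral_eq_lintegral_of_nonneg_ae (.of_forall fun x => by positivity) m₁,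
    integral_eq_lintegral_of_nonneg_ae (.of_forall fun x => by positivity) m₂]
  have := R.lintegral_pow_eq ω p (hh p).pos_part (R.posPart_ae_eq ω hh hv p)
  have e : ∀ (a : ℝ) (n : ℕ), ENNReal.ofReal (max a 0 ^ n) = ‖max a 0‖ₑ ^ n := fun a n => by
    rw [ENNReal.ofReal_pow (le_max_right _ _), Real.enorm_of_nonneg (le_max_right _ _)]
  simp only [e, this]

theorem integrable_posPart_pow {h : Y → ℝ} (p : ℕ) (hh : MemLp h ((p : ℝ≥0∞) + 1) μ) :
    Integrable (fun y => max (h y) 0 ^ (p + 1)) μ := by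
  refine ⟨hh.pos_part.1.pow _, ?_⟩
  have := lintegral_pow_lt_top p hh.pos_part
  simpa only [HasFiniteIntegral, enorm_pow] using this

theorem integral_pow_eq_posPart_negPart {h : Y → ℝ} (p : ℕ) (hh : MemLp h ((p : ℝ≥0∞) + 1) μ) :
    ∫ y, h y ^ (p + 1) ∂μ =
      ∫ y, max (h y) 0 ^ (p + 1) ∂μ + (-1) ^ (p + 1) * ∫ y, max (-h y) 0 ^ (p + 1) ∂μ := by
  have hneg : Integrable (fun y => max (-h y) 0 ^ (p + 1)) μ := integrable_posPart_pow p hh.neg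
  rw [← integral_const_mul, ← integral_add (integrable_posPart_pow p hh) (hneg.const_mul _)]
  refine integral_congr_ae (.of_forall fun y => ?_)
  rcases le_total 0 (h y) with ha | ha
  · simp [max_eq_left ha, max_eq_right (neg_nonpos.2 ha)]
  · simp only [max_eq_right ha, max_eq_left (neg_nonneg.2 ha), ne_eq, Nat.succ_ne_zero,
      not_false_eq_true, zero_pow, zero_add]
    rw [← mul_pow]; ring

theorem RandomIsometry.integral_pow_eq (R : RandomIsometry N μ σ) (ω : Configuration X)
    {h : Y → ℝ} (hh : ∀ p : Fin (N + 1), MemLp h (((p : ℕ) : ℝ≥0∞) + 1) μ) {v : X → ℝ}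
    (hv : ∀ p : Fin (N + 1), v =ᵐ[σ] R.toIsometry ω p ((hh p).toLp h)) (p : Fin (N + 1)) :
    ∫ x, v x ^ ((p : ℕ) + 1) ∂σ = ∫ y, h y ^ ((p : ℕ) + 1) ∂μ := by
  have hneg : ∀ p : Fin (N + 1), (fun x => -v x) =ᵐ[σ]
      R.toIsometry ω p ((hh p).neg.toLp fun y => -h y) := by
    intro p
    have : (hh p).neg.toLp (fun y => -h y) = -(hh p).toLp h := (hh p).toLp_neg
    rw [this, map_neg]
    filter_upwards [hv p, Lp.coeFn_neg (R.toIsometry ω p ((hh p).toLp h))] with x h1 h2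
    rw [h2, Pi.neg_apply, h1]
  have hvp : MemLp v (((p : ℕ) : ℝ≥0∞) + 1) σ := (Lp.memLp _).ae_eq (hv p).symm
  rw [integral_pow_eq_posPart_negPart _ hvp, integral_pow_eq_posPart_negPart _ (hh p),
    R.integral_posPart_pow ω hh hv p,
    R.integral_posPart_pow ω (fun p => (hh p).neg) hneg p]
  rfl

/-- `v` has the moments `H k` and absolute moments `A k` for `1 ≤ k ≤ N + 1`. -/
def HasMoments (σ : Measure X) (N : ℕ) (A : ℕ → ℝ≥0∞) (H : ℕ → ℝ) (v : X → ℝ) : Prop :=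
  ∀ k, 1 ≤ k → k ≤ N + 1 → ∫⁻ x, ‖v x‖ₑ ^ k ∂σ = A k ∧ ∫ x, v x ^ k ∂σ = H k

/-- This is all that the moment computation retains of `R`. -/
theorem IsVersion.hasMoments {π : Measure (Configuration X)} {R : RandomIsometry N μ σ}
    {h : Y → ℝ} {hh : ∀ p : Fin (N + 1), MemLp h (((p : ℕ) : ℝ≥0∞) + 1) μ}
    {u : Configuration X → X → ℝ} (hu : IsVersion π R h hh u) :
    ∀ᵐ ω ∂π, HasMoments σ N (fun k => ∫⁻ y, ‖h y‖ₑ ^ k ∂μ) (fun k => ∫ y, h y ^ k ∂μ) (u ω) := by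
  filter_upwards [hu] with ω hω k hk hkN
  obtain ⟨p, rfl⟩ : ∃ p, k = p + 1 := ⟨k - 1, by omega⟩
  let q : Fin (N + 1) := ⟨p, by omega⟩
  exact ⟨R.lintegral_pow_eq ω q (hh q) (hω q), R.integral_pow_eq ω hh hω q⟩

end

end

/-! ### Product measures, adding several points, and factorization of `shiftProd`. -/

section

section PiMeasure

variable {X : Type*} [MeasurableSpace X] (σ : Measure X) [SigmaFinite σ]

theorem measurePreserving_comp_equiv {ι κ : Type*} [Fintype ι] [Fintype κ] (e : κ ≃ ι) :
    MeasurePreserving (fun (s : ι → X) k => s (e k)) (Measure.pi fun _ => σ)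
      (Measure.pi fun _ => σ) := by
  have h := measurePreserving_piCongrLeft (fun _ : κ => σ) e.symm
  convert! h using 1
  ext s k
  obtain ⟨i, rfl⟩ := e.symm.surjective k
  rw [MeasurableEquiv.piCongrLeft_apply_apply, e.apply_symm_apply]

theorem measurePreserving_split {ι : Type*} [Fintype ι] [DecidableEq ι] (S : Finset ι) :
    MeasurePreserving (fun s : ι → X => ((fun i : S => s i), fun i : {i // i ∉ S} => s i))
      (Measure.pi fun _ => σ) ((Measure.pi fun _ => σ).prod (Measure.pi fun _ => σ)) := by
  convert! measurePreserving_piEquivPiSubtypeProd (fun _ : ι => σ) (· ∈ S)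

theorem measurePreserving_fin_cons (n : ℕ) :
    MeasurePreserving (fun z : X × (Fin n → X) => (Fin.cons z.1 z.2 : Fin (n + 1) → X))
      (σ.prod (Measure.pi fun _ => σ)) (Measure.pi fun _ => σ) := by
  have h := (measurePreserving_piFinSuccAbove (fun _ : Fin (n + 1) => σ) 0).symm
  convert! h using 1
  ext z i
  simp [MeasurableEquiv.piFinSuccAbove, Fin.insertNthEquiv]

theorem lintegral_enorm_fintype_prod {ι : Type*} [Fintype ι] {f : ι → X → ℝ}
    (hf : ∀ i, Integrable (f i) σ) :
    ∫⁻ s : ι → X, ‖∏ i, f i (s i)‖ₑ ∂(Measure.pi fun _ => σ) = ∏ i, ∫⁻ x, ‖f i x‖ₑ ∂σ := by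
  have hI : Integrable (fun s : ι → X => ∏ i, f i (s i)) (Measure.pi fun _ => σ) :=
    Integrable.fintype_prod_dep hf
  rw [← ofReal_integral_norm_eq_lintegral_enorm hI]
  simp_rw [norm_prod]
  rw [integral_fintype_prod_eq_prod (fun i x => ‖f i x‖),
    ENNReal.ofReal_prod_of_nonneg fun i _ => integral_nonneg fun _ => norm_nonneg _]
  exact Finset.prod_congr rfl fun i _ => ofReal_integral_norm_eq_lintegral_enorm (hf i)

end PiMeasure

section

variable {X : Type*} [MetricSpace X] [SigmaCompactSpace X] [MeasurableSpace X] [BorelSpace X]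
  {σ : Measure X} {π : Measure (Configuration X)}

open PoissonInvariance.Configuration

theorem _root_.Measurable.configuration_addPoints {Z ι : Type*} [MeasurableSpace Z]
    {f : Z → Configuration X} {g : Z → ι → X} (hf : Measurable f) (hg : Measurable g)
    (S : Finset ι) : Measurable fun z => (f z).addPoints (g z) S := by
  classical
  induction S using Finset.induction_on with
  | empty => simpa using hf
  | insert i S _ ih =>
    simp only [addPoints_insert]
    exact ih.configuration_insert (measurable_pi_iff.1 hg i)

theorem addPoints_fin_cons {n : ℕ} (ω : Configuration X) (x : X) (s : Fin n → X) :
    ω.addPoints (Fin.cons x s : Fin (n + 1) → X) Finset.univ =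
      (ω.insert x).addPoints s Finset.univ := by
  ext1
  simp [addPoints, Configuration.insert, Fin.range_cons, Set.insert_union]

theorem measurable_shiftProd {ι : Type*} [Fintype ι] [DecidableEq ι]
    {v : ι → Configuration X → X → ℝ} (hv : ∀ p, Measurable (Function.uncurry (v p)))
    (S : Finset ι) :
    Measurable fun z : Configuration X × (ι → X) => shiftProd v S z.1 z.2 := by
  refine Finset.measurable_fun_prod _ fun p _ => ?_
  exact (hv p).comp ((measurable_fst.configuration_addPoints measurable_snd _).prodMk
    ((measurable_pi_apply p).comp measurable_snd))

variable [SigmaFinite σ] [NullSingletonClass σ]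

/-- One use of `ae_insert` per added point. It makes the deterministic moments available for `u(ω ∪
{s_1, …, s_n})`, not only for `u(ω)`. -/
theorem IsPoisson.ae_addPoints_fin (hπ : IsPoisson σ π) {p : Configuration X → Prop}
    (hp : ∀ᵐ ω ∂π, p ω) (n : ℕ) :
    ∀ᵐ z ∂π.prod (Measure.pi fun _ : Fin n => σ), p (z.1.addPoints z.2 Finset.univ) := by
  have := hπ.isProbabilityMeasure
  -- A measurable null superset replaces the exceptional set so that Fubini's criterion for null
  -- sets applies.
  obtain ⟨E, hE, hEm, hE0⟩ := exists_measurable_superset_of_null (ae_iff.1 hp)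
  have hE' : ∀ ω, ω ∉ E → p ω := fun ω h => by_contra fun h' => h (hE h')
  suffices h : ∀ᵐ z ∂π.prod (Measure.pi fun _ : Fin n => σ),
      z.1.addPoints z.2 Finset.univ ∉ E from h.mono fun z => hE' _
  induction n with
  | zero =>
    have hq := (Measure.quasiMeasurePreserving_fst (μ := π)
      (ν := Measure.pi fun _ : Fin 0 => σ)).ae (measure_eq_zero_iff_ae_notMem.1 hE0)
    filter_upwards [hq] with z hz
    simpa using hz
  | succ n ih =>
    have hm : Measurable fun z : Configuration X × (Fin n → X) =>
        z.1.addPoints z.2 Finset.univ :=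
      measurable_fst.configuration_addPoints measurable_snd _
    have h1 := hπ.ae_insert (Measure.ae_ae_of_ae_prod ih)
    have hmi : Measurable fun z : (Configuration X × X) × (Fin n → X) =>
        (z.1.1.insert z.1.2).addPoints z.2 Finset.univ :=
      (measurable_fst.fst.configuration_insert measurable_fst.snd).configuration_addPoints
        measurable_snd _
    have h2 : ∀ᵐ z ∂(π.prod σ).prod (Measure.pi fun _ : Fin n => σ),
        (z.1.1.insert z.1.2).addPoints z.2 Finset.univ ∉ E :=
      (Measure.ae_prod_iff_ae_ae (hmi hEm).compl).2 h1
    have mp : MeasurePreserving (fun z : (Configuration X × X) × (Fin n → X) =>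
        (z.1.1, (Fin.cons z.1.2 z.2 : Fin (n + 1) → X)))
        ((π.prod σ).prod (Measure.pi fun _ : Fin n => σ))
        (π.prod (Measure.pi fun _ : Fin (n + 1) => σ)) :=
      ((MeasurePreserving.id π).prod (measurePreserving_fin_cons σ n)).comp
        (measurePreserving_prodAssoc π σ _)
    have hm' : Measurable fun z : Configuration X × (Fin (n + 1) → X) =>
        z.1.addPoints z.2 Finset.univ :=
      measurable_fst.configuration_addPoints measurable_snd _
    rw [← mp.map_eq]
    refine (ae_map_iff mp.measurable.aemeasurable (hm' hEm).compl).2 ?_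
    filter_upwards [h2] with z hz
    simpa only [Set.mem_preimage, addPoints_fin_cons] using hz

theorem IsPoisson.ae_addPoints (hπ : IsPoisson σ π) {p : Configuration X → Prop}
    (hp : ∀ᵐ ω ∂π, p ω) (ι : Type*) [Fintype ι] :
    ∀ᵐ z ∂π.prod (Measure.pi fun _ : ι => σ), p (z.1.addPoints z.2 Finset.univ) := by
  have := hπ.isProbabilityMeasure
  have e := (Fintype.equivFin ι).symm
  have mp := (MeasurePreserving.id π).prod (measurePreserving_comp_equiv σ e)
  have h := mp.quasiMeasurePreserving.ae (hπ.ae_addPoints_fin hp _)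
  filter_upwards [h] with z hz
  have : z.1.addPoints z.2 Finset.univ =
      z.1.addPoints (fun k => z.2 (e k)) Finset.univ := by
    have := z.1.addPoints_comp z.2 e.toEmbedding Finset.univ
    simpa using! this.symm
  rw [this]
  exact hz

end

section ShiftProd

variable {X : Type*} [TopologicalSpace X]

theorem shiftProd_comp_equiv {ι κ : Type*} [Fintype ι] [DecidableEq ι] [Fintype κ] [DecidableEq κ]
    (e : κ ≃ ι) (v : ι → Configuration X → X → ℝ) (ω : Configuration X) (s : ι → X) :
    shiftProd (fun k => v (e k)) Finset.univ ω (fun k => s (e k)) =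
      shiftProd v Finset.univ ω s := by
  simp only [shiftProd]
  rw [← e.prod_comp]
  refine Finset.prod_congr rfl fun p _ => ?_
  have := ω.addPoints_comp s e.toEmbedding (Finset.univ.erase p)
  rw [Finset.map_erase, Finset.map_univ_equiv] at this
  exact congrArg (fun η => v (e p) η (s (e p))) this

/-- A point outside `S` is never added to a configuration. Given `ω` and the points of `S`, the
remaining factors thus all use the one configuration `ω ∪ s_S` and depend on separate variables. -/
theorem shiftProd_split {ι : Type*} [Fintype ι] [DecidableEq ι] (S : Finset ι)
    (v : ι → Configuration X → X → ℝ) (ω : Configuration X) (s : ι → X) :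
    shiftProd v S ω s = shiftProd (fun p : S => v p) Finset.univ ω (fun p : S => s p) *
      ∏ q : {q // q ∉ S}, v q (ω.addPoints (fun p : S => s p) Finset.univ) (s q) := by
  simp only [shiftProd]
  rw [← Fintype.prod_subtype_mul_prod_subtype (· ∈ S)]
  congr 1
  · refine Finset.prod_congr (by ext; simp) fun p _ => ?_
    have := ω.addPoints_comp s (Function.Embedding.subtype (· ∈ S)) (Finset.univ.erase p)
    rw [Finset.map_erase] at this
    simp only [Finset.univ_eq_attach, Finset.attach_map_val, Function.Embedding.subtype_apply]
      at this ⊢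
    exact (congrArg (fun η => v p η (s p)) this).symm
  · refine Finset.prod_congr rfl fun q _ => ?_
    have := ω.addPoints_comp s (Function.Embedding.subtype (· ∈ S)) Finset.univ
    simp only [Finset.univ_eq_attach, Finset.attach_map_val] at this ⊢
    rw [Finset.erase_eq_of_notMem q.2]
    exact (congrArg (fun η => v q η (s q)) this).symm

end ShiftProd

end

/-! ### Joint moments: factorization, finiteness, and the integral of `bigDelta`. -/

section

open PoissonInvariance.Configuration

/-- The processes `u^{k_p}`. -/
abbrev powProcess {X ι : Type*} [TopologicalSpace X] (u : Configuration X → X → ℝ) (k : ι → ℕ) :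
    ι → Configuration X → X → ℝ :=
  fun p η x => u η x ^ k p

section Defs

variable {X : Type*} [TopologicalSpace X] [MeasurableSpace X]
  (σ : Measure X) (π : Measure (Configuration X)) (u : Configuration X → X → ℝ)

/-- `E ∫ ∏_p u(s_p)^{k_p}(ω ∪ {s_i : i ≠ p}) σ(ds)`. -/
def jointMoment {ι : Type*} [Fintype ι] [DecidableEq ι] (k : ι → ℕ) : ℝ :=
  ∫ z, shiftProd (powProcess u k) Finset.univ z.1 z.2 ∂π.prod (Measure.pi fun _ => σ)

/-- `E ∫ ∏_p |u(s_p)|^{k_p}(ω ∪ {s_i : i ≠ p}) σ(ds)`. -/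
def jointAbsMoment {ι : Type*} [Fintype ι] [DecidableEq ι] (k : ι → ℕ) : ℝ≥0∞ :=
  ∫⁻ z, ‖shiftProd (powProcess u k) Finset.univ z.1 z.2‖ₑ ∂π.prod (Measure.pi fun _ => σ)

/-- The standing assumptions on the process `u`. -/
structure IsMomentProcess (N : ℕ) (A : ℕ → ℝ≥0∞) (H : ℕ → ℝ) : Prop where
  isPoisson : IsPoisson σ π
  measurable : Measurable (Function.uncurry u)
  lt_top : ∀ k, 1 ≤ k → k ≤ N + 1 → A k < ∞
  hasMoments : ∀ᵐ ω ∂π, HasMoments σ N A H (u ω)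
  bigDelta_lt_top : ∀ (a : ℕ) (l : Fin (a + 1) → ℕ), (∀ p, 1 ≤ l p) → ∑ p, l p ≤ N + 1 →
      ∫⁻ ω, ∫⁻ s : Fin (a + 1) → X, ‖bigDelta (powProcess u l) s ω‖ₑ
        ∂(Measure.pi fun _ => σ) ∂π < ∞

end Defs

namespace IsMomentProcess

variable {X : Type*} [MetricSpace X] [SigmaCompactSpace X] [MeasurableSpace X] [BorelSpace X]
  {σ : Measure X} [SigmaFinite σ] [NullSingletonClass σ] {π : Measure (Configuration X)}
  {u : Configuration X → X → ℝ} {N : ℕ} {A : ℕ → ℝ≥0∞} {H : ℕ → ℝ}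
  {ι : Type*} [Fintype ι] [DecidableEq ι]

section

variable (hu : Measurable (Function.uncurry u))
include hu

theorem measurable_shiftProd_pow (k : ι → ℕ) (S : Finset ι) :
    Measurable fun z : Configuration X × (ι → X) => shiftProd (powProcess u k) S z.1 z.2 :=
  measurable_shiftProd (fun p => hu.pow_const (k p)) S

theorem measurable_bigDelta_pow {m : ℕ} (k : Fin m → ℕ) :
    Measurable fun z : Configuration X × (Fin m → X) => bigDelta (powProcess u k) z.2 z.1 := by
  simp only [bigDelta_eq]
  exact Finset.measurable_fun_sum _ fun S _ => (measurable_shiftProd_pow hu k S).const_mul _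

end

theorem jointAbsMoment_comp_equiv [SFinite π] (hu : Measurable (Function.uncurry u))
    {κ : Type*} [Fintype κ] [DecidableEq κ]
    (e : κ ≃ ι) (k : ι → ℕ) :
    jointAbsMoment σ π u (fun i => k (e i)) = jointAbsMoment σ π u k := by
  have mp := (MeasurePreserving.id π).prod (measurePreserving_comp_equiv σ e)
  rw [jointAbsMoment, ← mp.lintegral_comp (measurable_shiftProd_pow hu _ _).enorm]
  refine lintegral_congr fun z => ?_
  rw [← shiftProd_comp_equiv e (powProcess u k) z.1 z.2]
  rfl

theorem jointMoment_comp_equiv [SFinite π] (hu : Measurable (Function.uncurry u))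
    {κ : Type*} [Fintype κ] [DecidableEq κ]
    (e : κ ≃ ι) (k : ι → ℕ) :
    jointMoment σ π u (fun i => k (e i)) = jointMoment σ π u k := by
  have mp := (MeasurePreserving.id π).prod (measurePreserving_comp_equiv σ e)
  rw [jointMoment, ← mp.map_eq, integral_map mp.measurable.aemeasurable
    (measurable_shiftProd_pow hu _ _).aestronglyMeasurable]
  refine integral_congr_ae (.of_forall fun z => ?_)
  simp only
  rw [← shiftProd_comp_equiv e (powProcess u k) z.1 z.2]
  rfl

variable (h : IsMomentProcess σ π u N A H)
include h

theorem integrable_pow {v : X → ℝ} (hv : Measurable v) (hm : HasMoments σ N A H v) {k : ℕ}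
    (hk : 1 ≤ k) (hkN : k ≤ N + 1) : Integrable (fun x => v x ^ k) σ := by
  refine ⟨(hv.pow_const k).aestronglyMeasurable, ?_⟩
  simpa only [HasFiniteIntegral, enorm_pow, (hm k hk hkN).1] using h.lt_top k hk hkN

theorem measurable_right (ω : Configuration X) : Measurable (u ω) :=
  h.measurable.comp measurable_prodMk_left

/-- The auxiliary factorization of `shiftProd` over `S` and its complement. -/
theorem measurePreserving_split_prod [SFinite π] (S : Finset ι) :
    MeasurePreserving (fun z : Configuration X × (ι → X) =>
      ((z.1, fun i : S => z.2 i), fun i : {i // i ∉ S} => z.2 i))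
      (π.prod (Measure.pi fun _ => σ))
      ((π.prod (Measure.pi fun _ => σ)).prod (Measure.pi fun _ => σ)) :=
  ((measurePreserving_prodAssoc π (Measure.pi fun _ : S => σ)
      (Measure.pi fun _ : {i // i ∉ S} => σ)).symm (e := MeasurableEquiv.prodAssoc)).comp
    ((MeasurePreserving.id π).prod (measurePreserving_split σ S))

theorem measurable_compl_prod (k : ι → ℕ) (S : Finset ι) :
    Measurable fun z : (Configuration X × (S → X)) × ({q // q ∉ S} → X) =>
      ∏ q : {q // q ∉ S}, u (z.1.1.addPoints z.1.2 Finset.univ) (z.2 q) ^ k q := by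
  refine Finset.measurable_fun_prod _ fun q _ => ?_
  exact (h.measurable.comp ((measurable_fst.fst.configuration_addPoints measurable_fst.snd
    Finset.univ).prodMk ((measurable_pi_apply q).comp measurable_snd))).pow_const _

/-- By `shiftProd_split` the variables outside `S` are independent given `ω ∪ s_S`, whose process
almost surely has the absolute moments `A k`. -/
theorem lintegral_enorm_shiftProd {k : ι → ℕ} (hk : ∀ i, 1 ≤ k i) (hkN : ∀ i, k i ≤ N + 1)
    (S : Finset ι) :
    ∫⁻ z, ‖shiftProd (powProcess u k) S z.1 z.2‖ₑ ∂π.prod (Measure.pi fun _ => σ) =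
      jointAbsMoment σ π u (fun i : S => k i) * ∏ q : {q // q ∉ S}, A (k q) := by
  have := h.isPoisson.isProbabilityMeasure
  have mp := h.measurePreserving_split_prod (ι := ι) S
  have m1 : Measurable fun w : Configuration X × (S → X) =>
      ‖shiftProd (powProcess u fun i : S => k i) Finset.univ w.1 w.2‖ₑ :=
    (measurable_shiftProd_pow h.measurable (fun i : S => k i) Finset.univ).enorm
  have m2 := (h.measurable_compl_prod k S).enorm
  let F : (Configuration X × (S → X)) × ({q // q ∉ S} → X) → ℝ≥0∞ := fun w =>
    ‖shiftProd (powProcess u fun i : S => k i) Finset.univ w.1.1 w.1.2‖ₑ *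
      ‖∏ q : {q // q ∉ S}, u (w.1.1.addPoints w.1.2 Finset.univ) (w.2 q) ^ k q‖ₑ
  have hF : Measurable F := (m1.comp measurable_fst).mul m2
  calc
    _ = ∫⁻ z : Configuration X × (ι → X), F ((z.1, fun i : S => z.2 i),
          fun i : {i // i ∉ S} => z.2 i) ∂π.prod (Measure.pi fun _ => σ) :=
      lintegral_congr fun z => by rw [shiftProd_split, enorm_mul]
    _ = ∫⁻ w, F w ∂(π.prod (Measure.pi fun _ => σ)).prod (Measure.pi fun _ => σ) :=
      mp.lintegral_comp hF
    _ = _ := ?_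
  rw [lintegral_prod _ hF.aemeasurable, jointAbsMoment, ← lintegral_mul_const _ m1]
  refine lintegral_congr_ae ?_
  filter_upwards [h.isPoisson.ae_addPoints h.hasMoments S] with z hz
  have m3 : Measurable fun y : {q // q ∉ S} → X =>
      ‖∏ q : {q // q ∉ S}, u (z.1.addPoints z.2 Finset.univ) (y q) ^ k q‖ₑ :=
    (Finset.measurable_fun_prod _ fun q _ =>
      ((h.measurable_right _).comp (measurable_pi_apply q)).pow_const _).enorm
  simp only [F]
  rw [lintegral_const_mul _ m3]
  congr 1
  rw [lintegral_enorm_fintype_prod σ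
    (f := fun (q : {q // q ∉ S}) x => u (z.1.addPoints z.2 Finset.univ) x ^ k q)]
  · exact Finset.prod_congr rfl fun q _ => by
      simpa only [enorm_pow] using (hz _ (hk q) (hkN q)).1
  · exact fun q => h.integrable_pow (h.measurable_right _) hz (hk q) (hkN q)

theorem integrable_shiftProd {k : ι → ℕ} (hk : ∀ i, 1 ≤ k i) (hkN : ∀ i, k i ≤ N + 1)
    {S : Finset ι} (hS : jointAbsMoment σ π u (fun i : S => k i) < ∞) :
    Integrable (fun z : Configuration X × (ι → X) => shiftProd (powProcess u k) S z.1 z.2)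
      (π.prod (Measure.pi fun _ => σ)) := by
  refine ⟨(measurable_shiftProd_pow h.measurable k S).aestronglyMeasurable, ?_⟩
  rw [HasFiniteIntegral, h.lintegral_enorm_shiftProd hk hkN]
  exact ENNReal.mul_lt_top hS (ENNReal.prod_lt_top fun q _ => h.lt_top _ (hk q) (hkN q))

theorem integral_shiftProd {k : ι → ℕ} (hk : ∀ i, 1 ≤ k i) (hkN : ∀ i, k i ≤ N + 1)
    {S : Finset ι} (hS : jointAbsMoment σ π u (fun i : S => k i) < ∞) :
    ∫ z, shiftProd (powProcess u k) S z.1 z.2 ∂π.prod (Measure.pi fun _ => σ) =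
      jointMoment σ π u (fun i : S => k i) * ∏ q ∈ Finset.univ \ S, H (k q) := by
  have := h.isPoisson.isProbabilityMeasure
  have mp := h.measurePreserving_split_prod (ι := ι) S
  let F : (Configuration X × (S → X)) × ({q // q ∉ S} → X) → ℝ := fun w =>
    shiftProd (powProcess u fun i : S => k i) Finset.univ w.1.1 w.1.2 *
      ∏ q : {q // q ∉ S}, u (w.1.1.addPoints w.1.2 Finset.univ) (w.2 q) ^ k q
  have hF : Measurable F :=
    ((measurable_shiftProd_pow h.measurable (fun i : S => k i) Finset.univ).comp
      measurable_fst).mul (h.measurable_compl_prod k S)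
  have hFz : ∀ z : Configuration X × (ι → X), shiftProd (powProcess u k) S z.1 z.2 =
      F ((z.1, fun i : S => z.2 i), fun i : {i // i ∉ S} => z.2 i) := fun z => by
    rw [shiftProd_split]
  have hI := h.integrable_shiftProd hk hkN hS
  simp only [hFz] at hI ⊢
  have hI' := (mp.integrable_comp hF.aestronglyMeasurable).1 hI
  have e := integral_map (μ := π.prod (Measure.pi fun _ => σ)) mp.measurable.aemeasurable
    (f := F) hF.aestronglyMeasurable
  rw [mp.map_eq] at e
  rw [← e, integral_prod _ hI', jointMoment, ← integral_mul_const]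
  refine integral_congr_ae ?_
  filter_upwards [h.isPoisson.ae_addPoints h.hasMoments S] with z hz
  simp only [F]
  rw [integral_const_mul, integral_fintype_prod_eq_prod
    (fun (q : {q // q ∉ S}) x => u (z.1.addPoints z.2 Finset.univ) x ^ k q)]
  congr 1
  rw [Finset.prod_subtype (Finset.univ \ S) (p := (· ∉ S)) (by simp)]
  exact Finset.prod_congr rfl fun q _ => (hz _ (hk q) (hkN q)).2

/-- In `bigDelta_eq` the term `S = univ` is the product to be bounded. Every other term factors into
a joint moment with fewer variables and finite constants `A k`, so the assumed integrability of
`bigDelta` closes a strong induction on `m`. -/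
theorem jointAbsMoment_fin_lt_top (m : ℕ) (k : Fin m → ℕ) (hk : ∀ i, 1 ≤ k i)
    (hs : ∑ i, k i ≤ N + 1) : jointAbsMoment σ π u k < ∞ := by
  have := h.isPoisson.isProbabilityMeasure
  induction m using Nat.strong_induction_on with
  | _ m ih =>
  rcases m with _ | a
  · rw [jointAbsMoment]
    have e : ∀ z : Configuration X × (Fin 0 → X),
        ‖shiftProd (powProcess u k) Finset.univ z.1 z.2‖ₑ = 1 := fun z => by simp [shiftProd]
    have : IsProbabilityMeasure (Measure.pi fun _ : Fin 0 => σ) := ⟨by simp⟩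
    simp only [e]
    simp
  · have hkN : ∀ i, k i ≤ N + 1 := fun i =>
      (Finset.single_le_sum (fun i _ => Nat.zero_le (k i)) (Finset.mem_univ i)).trans hs
    have hsub : ∀ S : Finset (Fin (a + 1)), S ≠ Finset.univ →
        jointAbsMoment σ π u (fun i : S => k i) < ∞ := by
      intro S hS
      have hc : S.card < a + 1 := by
        simpa using Finset.card_lt_univ_of_notMem (s := S)
          (by simpa [Finset.eq_univ_iff_forall] using hS : ∃ x, x ∉ S).choose_spec
      rw [← jointAbsMoment_comp_equiv h.measurable S.equivFin.symm]
      refine ih _ hc _ (fun i => hk _) ?_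
      refine le_trans (le_of_eq ?_) ((Finset.sum_le_univ_sum_of_nonneg (s := S)
        fun i => Nat.zero_le (k i)).trans hs)
      rw [S.equivFin.symm.sum_comp fun i : S => k i]
      exact Finset.sum_coe_sort S k
    have hD : ∫⁻ z, ‖bigDelta (powProcess u k) z.2 z.1‖ₑ ∂π.prod (Measure.pi fun _ => σ) < ∞ := by
      rw [lintegral_prod _ (measurable_bigDelta_pow h.measurable k).enorm.aemeasurable]
      exact h.bigDelta_lt_top a k hk hs
    have hle : ∀ z : Configuration X × (Fin (a + 1) → X),
        ‖shiftProd (powProcess u k) Finset.univ z.1 z.2‖ₑ ≤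
          ‖bigDelta (powProcess u k) z.2 z.1‖ₑ + ∑ S ∈ Finset.univ.erase Finset.univ,
            ‖shiftProd (powProcess u k) S z.1 z.2‖ₑ := by
      intro z
      have e : shiftProd (powProcess u k) Finset.univ z.1 z.2 =
          bigDelta (powProcess u k) z.2 z.1 - ∑ S ∈ Finset.univ.erase Finset.univ,
            (∏ _i ∈ Finset.univ \ S, (-1 : ℝ)) * shiftProd (powProcess u k) S z.1 z.2 := by
        rw [bigDelta_eq, ← Finset.add_sum_erase _ _ (Finset.mem_univ Finset.univ)]
        simp
      rw [e]
      refine enorm_sub_le.trans (add_le_add le_rfl ((enorm_sum_le _ _).trans ?_))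
      refine Finset.sum_le_sum fun S _ => ?_
      rw [enorm_mul, Finset.prod_const, enorm_pow]
      simp
    refine (lintegral_mono hle).trans_lt ?_
    rw [lintegral_add_left (measurable_bigDelta_pow h.measurable k).enorm,
      lintegral_finsetSum _ fun S _ => (measurable_shiftProd_pow h.measurable k S).enorm]
    refine ENNReal.add_lt_top.2 ⟨hD, ENNReal.sum_lt_top.2 fun S hS => ?_⟩
    rw [h.lintegral_enorm_shiftProd hk hkN]
    exact ENNReal.mul_lt_top (hsub S (Finset.ne_of_mem_erase hS))
      (ENNReal.prod_lt_top fun q _ => h.lt_top _ (hk q) (hkN q))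

theorem jointAbsMoment_lt_top (k : ι → ℕ) (hk : ∀ i, 1 ≤ k i)
    (hs : ∑ i, k i ≤ N + 1) : jointAbsMoment σ π u k < ∞ := by
  have := h.isPoisson.isProbabilityMeasure
  rw [← jointAbsMoment_comp_equiv h.measurable (Fintype.equivFin ι).symm]
  refine h.jointAbsMoment_fin_lt_top _ _ (fun i => hk _) ?_
  rwa [(Fintype.equivFin ι).symm.sum_comp fun i => k i]

theorem jointAbsMoment_restrict_lt_top (k : ι → ℕ) (hk : ∀ i, 1 ≤ k i)
    (hs : ∑ i, k i ≤ N + 1) (S : Finset ι) : jointAbsMoment σ π u (fun i : S => k i) < ∞ := by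
  refine h.jointAbsMoment_lt_top _ (fun i => hk _) ?_
  refine le_trans (le_of_eq ?_) ((Finset.sum_le_univ_sum_of_nonneg (s := S)
    fun i => Nat.zero_le (k i)).trans hs)
  exact Finset.sum_coe_sort S k

/-- Termwise integration of `bigDelta_eq`; each sign `-1` is absorbed into the factor `H (k i)` of
the variable integrated out. -/
theorem integral_bigDelta {m : ℕ} (k : Fin m → ℕ) (hk : ∀ i, 1 ≤ k i)
    (hs : ∑ i, k i ≤ N + 1) :
    ∫ ω, ∫ s : Fin m → X, bigDelta (powProcess u k) s ω ∂(Measure.pi fun _ => σ) ∂π =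
      ∑ S : Finset (Fin m), (∏ i ∈ Finset.univ \ S, -H (k i)) *
        jointMoment σ π u (fun i : S => k i) := by
  have := h.isPoisson.isProbabilityMeasure
  have hkN : ∀ i, k i ≤ N + 1 := fun i =>
    (Finset.single_le_sum (fun i _ => Nat.zero_le (k i)) (Finset.mem_univ i)).trans hs
  have hfin := h.jointAbsMoment_restrict_lt_top k hk hs
  have hI : ∀ S ∈ (Finset.univ : Finset (Finset (Fin m))), Integrable
      (fun z : Configuration X × (Fin m → X) => (∏ _i ∈ Finset.univ \ S, (-1 : ℝ)) *
        shiftProd (powProcess u k) S z.1 z.2) (π.prod (Measure.pi fun _ => σ)) :=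
    fun S _ => (h.integrable_shiftProd hk hkN (hfin S)).const_mul _
  have hI' := integrable_finsetSum _ hI
  simp only [bigDelta_eq]
  rw [← integral_prod (f := fun z : Configuration X × (Fin m → X) => ∑ S : Finset (Fin m),
    (∏ _i ∈ Finset.univ \ S, (-1 : ℝ)) * shiftProd (powProcess u k) S z.1 z.2) hI',
    integral_finsetSum _ hI]
  refine Finset.sum_congr rfl fun S _ => ?_
  rw [integral_const_mul, h.integral_shiftProd hk hkN (hfin S), mul_comm (jointMoment _ _ _ _),
    ← mul_assoc, ← Finset.prod_mul_distrib]
  simp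

end IsMomentProcess

end

/-! ### Mixed moments and the recursion given by the Mecke formula. -/

section

open PoissonInvariance.Configuration

section Pointwise

variable {X : Type*} [TopologicalSpace X]

/-- The other factors see `t` as a point of the configuration, whereas the factor at `t` sees only
`ω ∪ {s}`. This is the shape that the Mecke formula produces. -/
theorem shiftProd_fin_cons {n : ℕ} (u : Configuration X → X → ℝ) (j : ℕ) (k : Fin n → ℕ)
    (ω : Configuration X) (t : X) (s : Fin n → X) :
    shiftProd (powProcess u (Fin.cons j k : Fin (n + 1) → ℕ)) Finset.univ ω
        (Fin.cons t s : Fin (n + 1) → X) =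
      u (ω.addPoints s Finset.univ) t ^ j *
        shiftProd (powProcess u k) Finset.univ (ω.insert t) s := by
  have hsucc : ∀ S : Finset (Fin n), ω.addPoints (Fin.cons t s : Fin (n + 1) → X)
      (S.map (Fin.succEmb n)) = ω.addPoints s S := fun S => by
    rw [← addPoints_comp]; congr 1
  simp only [shiftProd]
  rw [Fin.prod_univ_succ]
  congr 1
  · have e : (Finset.univ.erase 0 : Finset (Fin (n + 1))) = Finset.univ.map (Fin.succEmb n) := by
      ext i; cases i using Fin.cases <;> simp
    rw [e, hsucc]
    rfl
  · refine Finset.prod_congr rfl fun q _ => ?_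
    have e : (Finset.univ.erase q.succ : Finset (Fin (n + 1))) =
        Insert.insert 0 ((Finset.univ.erase q).map (Fin.succEmb n)) := by
      ext i; cases i using Fin.cases with
      | zero => simp [(Fin.succ_ne_zero q).symm]
      | succ i => simp
    have e2 := insert_addPoints ω (Fin.cons t s : Fin (n + 1) → X) 0
      ((Finset.univ.erase q).map (Fin.succEmb n))
    rw [e, ← e2, Fin.cons_zero]
    have e3 : (ω.insert t).addPoints (Fin.cons t s : Fin (n + 1) → X)
        ((Finset.univ.erase q).map (Fin.succEmb n)) =
          (ω.insert t).addPoints s (Finset.univ.erase q) := by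
      rw [← addPoints_comp]; congr 1
    rw [e3]
    simp [powProcess]

end Pointwise

section

variable {X : Type*} [MetricSpace X] [SigmaCompactSpace X] [MeasurableSpace X] [BorelSpace X]

theorem Configuration.measurableSet_mem_carrier :
    MeasurableSet {z : Configuration X × X | z.2 ∈ z.1.carrier} := by
  have hs : MeasurableSet {z : (Configuration X × X) × X | z.2 = z.1.2} :=
    measurableSet_eq_fun measurable_snd measurable_fst.snd
  have hm := Kernel.measurable_kernel_prodMk_left (κ := (countKernel X).prodMkRight X) hs
  have e : {z : Configuration X × X | z.2 ∈ z.1.carrier} =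
      {z | z.1.toMeasure {z.2} ≠ 0} := by
    ext z
    simp only [Set.mem_ofPred_eq, ne_eq]
    rw [toMeasure_apply _ (measurableSet_singleton _), ENNReal.tsum_eq_zero]
    constructor
    · intro h h'
      simpa [h] using h' z.2
    · intro h
      by_contra h'
      refine h fun x => ?_
      by_cases hx : x = z.2
      · subst hx; simp [h']
      · simp [hx]
  rw [e]
  have hm' : Measurable fun z : Configuration X × X => z.1.toMeasure {z.2} := by
    simpa only [Kernel.prodMkRight_apply, countKernel_apply] using! hm
  exact hm' (measurableSet_singleton 0).compl

theorem Configuration.ae_prod_notMem_carrier {Z : Type*} [MeasurableSpace Z] (ρ : Measure Z)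
    {f : Z → Configuration X} (hf : Measurable f) (σ : Measure X)
    [SFinite σ] [NullSingletonClass σ] :
    ∀ᵐ z ∂ρ.prod σ, z.2 ∉ (f z.1).carrier := by
  have hm : MeasurableSet {z : Z × X | z.2 ∉ (f z.1).carrier} :=
    (((hf.comp measurable_fst).prodMk measurable_snd) measurableSet_mem_carrier).compl
  exact (Measure.ae_prod_iff_ae_ae hm).2 (.of_forall fun z => ae_notMem_carrier σ (f z))

/-- `∫ u_t((ω \ {t}) ∪ {s_1, …, s_n}) ω(dt)`. -/
def shiftedIntegral (u : Configuration X → X → ℝ) {n : ℕ} (ω : Configuration X)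
    (s : Fin n → X) : ℝ :=
  ∫ t, u ((ω.erase t).addPoints s Finset.univ) t ∂ω.toMeasure

variable {u : Configuration X → X → ℝ} (hu : Measurable (Function.uncurry u))
include hu

theorem measurable_shifted_integrand (n : ℕ) :
    Measurable fun z : (Configuration X × (Fin n → X)) × X =>
      u ((z.1.1.erase z.2).addPoints z.1.2 Finset.univ) z.2 :=
  hu.comp (((measurable_fst.fst.configuration_erase measurable_snd).configuration_addPoints
    measurable_fst.snd _).prodMk measurable_snd)

theorem measurable_shifted_integrand_right {n : ℕ} (ω : Configuration X) (s : Fin n → X) :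
    Measurable fun t => u ((ω.erase t).addPoints s Finset.univ) t :=
  hu.comp (((measurable_const.configuration_erase measurable_id).configuration_addPoints
    measurable_const _).prodMk measurable_id)

theorem measurable_shiftedIntegral (n : ℕ) :
    Measurable fun z : Configuration X × (Fin n → X) => shiftedIntegral u z.1 z.2 := by
  have h := (measurable_shifted_integrand hu n).stronglyMeasurable
  exact (StronglyMeasurable.integral_kernel_prod_right
    (κ := (countKernel X).prodMkRight (Fin n → X))
    (f := fun z t => u ((z.1.erase t).addPoints z.2 Finset.univ) t) h).measurable

/-- The new atom `t` contributes `u_t` at `ω ∪ {s}`, since erasing `t` restores `ω`. For the old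
atoms `t'`, the point `t` survives the erasure and can be counted among the added points. -/
theorem shiftedIntegral_insert {n : ℕ} {ω : Configuration X} {t : X} (s : Fin n → X)
    (ht : t ∉ ω.carrier)
    (hfin : ∫⁻ t', ‖u ((ω.erase t').addPoints (Fin.cons t s : Fin (n + 1) → X) Finset.univ) t'‖ₑ
      ∂ω.toMeasure < ∞) :
    shiftedIntegral u (ω.insert t) s = u (ω.addPoints s Finset.univ) t +
      shiftedIntegral u ω (Fin.cons t s : Fin (n + 1) → X) := by
  have hae : (fun t' => u ((ω.erase t').addPoints (Fin.cons t s : Fin (n + 1) → X)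
      Finset.univ) t') =ᵐ[ω.toMeasure]
      fun t' => u (((ω.insert t).erase t').addPoints s Finset.univ) t' := by
    refine (ae_toMeasure_iff ω).2 fun t' ht' => ?_
    simp only
    congr 1
    rw [addPoints_fin_cons]
    congr 1
    have hne : t ≠ t' := fun h => ht (h ▸ ht')
    ext1
    simp only [Configuration.insert, Configuration.erase]
    rw [Set.union_sdiff_distrib, Set.sdiff_singleton_eq_self (a := t') (s := {t})
      (by simpa using hne.symm)]
  have hI : Integrable (fun t' => u ((ω.erase t').addPoints (Fin.cons t s : Fin (n + 1) → X)
      Finset.univ) t') ω.toMeasure :=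
    ⟨(measurable_shifted_integrand_right hu ω _).aestronglyMeasurable, hfin⟩
  rw [shiftedIntegral, toMeasure_insert ht, integral_add_measure (hI.congr hae)
    (integrable_dirac enorm_lt_top), integral_dirac, erase_insert ht, add_comm, shiftedIntegral,
    integral_congr_ae hae]

end

namespace IsMomentProcess

variable {X : Type*} [MetricSpace X] [SigmaCompactSpace X] [MeasurableSpace X] [BorelSpace X]
  {σ : Measure X} [SigmaFinite σ] [NullSingletonClass σ] {π : Measure (Configuration X)}
  {u : Configuration X → X → ℝ} {N : ℕ} {A : ℕ → ℝ≥0∞} {H : ℕ → ℝ}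
  (h : IsMomentProcess σ π u N A H)
include h

theorem ae_lintegral_erase_lt_top :
    ∀ᵐ ω ∂π, ∫⁻ t, ‖u (ω.erase t) t‖ₑ ∂ω.toMeasure < ∞ := by
  have := h.isPoisson.isProbabilityMeasure
  have hm : Measurable fun z : Configuration X × X => ‖u (z.1.erase z.2) z.2‖ₑ :=
    (h.measurable.comp (measurable_erase.prodMk measurable_snd)).enorm
  refine ae_lt_top (hm.lintegral_kernel_prod_right' (κ := countKernel X)) ?_
  have e := h.isPoisson.lintegral_lintegral_toMeasure hm
  rw [e]
  have e2 : ∀ᵐ ω ∂π, ∫⁻ t, ‖u ((ω.insert t).erase t) t‖ₑ ∂σ = A 1 := by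
    filter_upwards [h.hasMoments] with ω hω
    rw [← (hω 1 le_rfl (by omega)).1]
    refine lintegral_congr_ae ?_
    filter_upwards [Configuration.ae_notMem_carrier σ ω] with t ht
    rw [erase_insert ht, pow_one]
  rw [lintegral_congr_ae e2]
  simpa using (h.lt_top 1 le_rfl (by omega)).ne

/-- Almost surely the points `s` avoid `ω`, so this sum is part of the sum over all atoms of `ω ∪
{s}`, and the latter is finite by `ae_addPoints`. -/
theorem ae_lintegral_shifted_lt_top (n : ℕ) :
    ∀ᵐ z ∂π.prod (Measure.pi fun _ : Fin n => σ),
      ∫⁻ t, ‖u ((z.1.erase t).addPoints z.2 Finset.univ) t‖ₑ ∂z.1.toMeasure < ∞ := by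
  have := h.isPoisson.isProbabilityMeasure
  have hdisj : ∀ᵐ z ∂π.prod (Measure.pi fun _ : Fin n => σ), ∀ i, z.2 i ∉ z.1.carrier := by
    rw [ae_all_iff]
    intro i
    exact (QuasiMeasurePreserving.prodMap (Measure.QuasiMeasurePreserving.id π)
      (Measure.quasiMeasurePreserving_eval (fun _ : Fin n => σ) i)).ae
      (Configuration.ae_prod_notMem_carrier π measurable_id σ)
  filter_upwards [h.isPoisson.ae_addPoints h.ae_lintegral_erase_lt_top (Fin n), hdisj]
    with z hz hd
  refine lt_of_le_of_lt ?_ hz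
  rw [lintegral_toMeasure, lintegral_toMeasure]
  have e : ∀ t : z.1.carrier, ‖u ((z.1.erase t).addPoints z.2 Finset.univ) t‖ₑ =
      ‖u ((z.1.addPoints z.2 Finset.univ).erase t) t‖ₑ := by
    intro t
    congr 2
    ext1
    simp only [addPoints, Configuration.erase]
    rw [Set.union_sdiff_distrib, Set.sdiff_singleton_eq_self (a := (t : X)) (s := z.2 '' _)]
    rintro ⟨i, -, hi⟩
    exact hd i (hi ▸ t.2)
  simp_rw [e]
  exact ENNReal.tsum_mono_subtype (fun t => ‖u ((z.1.addPoints z.2 Finset.univ).erase t) t‖ₑ)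
    Set.subset_union_left

/-- `E ∫ ∏_p u(s_p)^{k_p}(ω ∪ {s_q : q ≠ p}) (∫ u_t((ω \ {t}) ∪ {s}) ω(dt))^i σ(ds)`. -/
def _root_.PoissonInvariance.mixedMoment (σ : Measure X) (π : Measure (Configuration X))
    (u : Configuration X → X → ℝ) {n : ℕ} (k : Fin n → ℕ) (i : ℕ) : ℝ :=
  ∫ z, shiftProd (powProcess u k) Finset.univ z.1 z.2 * shiftedIntegral u z.1 z.2 ^ i
    ∂π.prod (Measure.pi fun _ => σ)

theorem measurePreserving_fin_cons_prod [SFinite π] (n : ℕ) :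
    MeasurePreserving (fun z : (Configuration X × (Fin n → X)) × X =>
        (z.1.1, (Fin.cons z.2 z.1.2 : Fin (n + 1) → X)))
      ((π.prod (Measure.pi fun _ => σ)).prod σ) (π.prod (Measure.pi fun _ => σ)) :=
  ((MeasurePreserving.id π).prod (measurePreserving_fin_cons σ n)).comp
    (((MeasurePreserving.id π).prod Measure.measurePreserving_swap).comp
      (measurePreserving_prodAssoc π (Measure.pi fun _ : Fin n => σ) σ))

/-- One of the `i + 1` factors is opened up as an integral against `ω(dt)` and transformed by the
Mecke formula. The other `i` factors become `(u_t + shiftedIntegral)^i`; in its binomial expansion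
the powers of `u_t` merge with the opened factor into an exponent `r + 1` for the new variable `t`.
-/
theorem mixedMoment_succ_aux {n : ℕ} (k : Fin n → ℕ) (i : ℕ)
    (hI : ∀ r ∈ Finset.range (i + 1), Integrable (fun z : Configuration X × (Fin (n + 1) → X) =>
      shiftProd (powProcess u (Fin.cons (r + 1) k : Fin (n + 1) → ℕ)) Finset.univ z.1 z.2 *
        shiftedIntegral u z.1 z.2 ^ (i - r)) (π.prod (Measure.pi fun _ => σ))) :
    Integrable (fun z : Configuration X × (Fin n → X) =>
      shiftProd (powProcess u k) Finset.univ z.1 z.2 * shiftedIntegral u z.1 z.2 ^ (i + 1))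
      (π.prod (Measure.pi fun _ => σ)) ∧
    mixedMoment σ π u k (i + 1) = ∑ r ∈ Finset.range (i + 1), (i.choose r : ℝ) *
      mixedMoment σ π u (Fin.cons (r + 1) k : Fin (n + 1) → ℕ) (i - r) := by
  have := h.isPoisson.isProbabilityMeasure
  let F : (Configuration X × (Fin n → X)) × X → ℝ := fun w =>
    shiftProd (powProcess u k) Finset.univ w.1.1 w.1.2 * shiftedIntegral u w.1.1 w.1.2 ^ i *
      u ((w.1.1.erase w.2).addPoints w.1.2 Finset.univ) w.2
  let G : ℕ → Configuration X × (Fin (n + 1) → X) → ℝ := fun r z =>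
    (i.choose r : ℝ) *
      (shiftProd (powProcess u (Fin.cons (r + 1) k : Fin (n + 1) → ℕ)) Finset.univ z.1 z.2 *
        shiftedIntegral u z.1 z.2 ^ (i - r))
  have hF : Measurable F :=
    (((measurable_shiftProd_pow h.measurable k Finset.univ).mul
      ((measurable_shiftedIntegral h.measurable n).pow_const i)).comp measurable_fst).mul
      (measurable_shifted_integrand h.measurable n)
  have hG : ∀ r ∈ Finset.range (i + 1), Integrable (G r) (π.prod (Measure.pi fun _ => σ)) :=
    fun r hr => (hI r hr).const_mul _
  have hGs : Integrable (fun z => ∑ r ∈ Finset.range (i + 1), G r z)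
      (π.prod (Measure.pi fun _ => σ)) := integrable_finsetSum _ hG
  have mp := h.measurePreserving_fin_cons_prod n
  have hins : Measurable fun z : (Configuration X × (Fin n → X)) × X =>
      ((z.1.1.insert z.2, z.1.2), z.2) :=
    ((measurable_fst.fst.configuration_insert measurable_snd).prodMk
      measurable_fst.snd).prodMk measurable_snd
  have hae : (fun w : (Configuration X × (Fin n → X)) × X =>
      F ((w.1.1.insert w.2, w.1.2), w.2)) =ᵐ[(π.prod (Measure.pi fun _ => σ)).prod σ]
      fun w => ∑ r ∈ Finset.range (i + 1),
        G r (w.1.1, (Fin.cons w.2 w.1.2 : Fin (n + 1) → X)) := by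
    filter_upwards [Configuration.ae_prod_notMem_carrier (π.prod (Measure.pi fun _ => σ))
      measurable_fst σ, mp.quasiMeasurePreserving.ae (h.ae_lintegral_shifted_lt_top (n + 1))]
      with w hw hw'
    simp only [F, G, shiftProd_fin_cons]
    rw [shiftedIntegral_insert h.measurable _ hw hw', erase_insert hw, add_pow,
      Finset.mul_sum, Finset.sum_mul]
    refine Finset.sum_congr rfl fun r _ => ?_
    rw [pow_succ]
    ring
  -- Integrability is read off on the far side of the Mecke formula, where it is the hypothesis on
  -- the terms `G r`, and pulled back.
  have hint : Integrable F ((π.prod (Measure.pi fun _ => σ)).compProd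
      ((countKernel X).prodMkRight (Fin n → X))) := by
    rw [h.isPoisson.prod_compProd_countKernel,
      integrable_map_measure hF.aestronglyMeasurable hins.aemeasurable]
    exact (mp.integrable_comp_of_integrable hGs).congr hae.symm
  have hfib : ∀ z : Configuration X × (Fin n → X), ∫ t, F (z, t) ∂z.1.toMeasure =
      shiftProd (powProcess u k) Finset.univ z.1 z.2 * shiftedIntegral u z.1 z.2 ^ (i + 1) := by
    intro z
    simp only [F]
    rw [integral_const_mul, pow_succ, ← mul_assoc]
    rfl
  constructor
  -- That lemma concerns compositions of kernels, so the base measure is viewed as a constant kernel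
  -- on `Unit`.
  · have := Integrable.integral_compProd
      (κ := Kernel.const Unit (π.prod (Measure.pi fun _ : Fin n => σ)))
      (η := Kernel.prodMkLeft Unit ((countKernel X).prodMkRight (Fin n → X))) (a := ()) hint
    simpa only [Kernel.prodMkRight_apply, Kernel.prodMkLeft_apply, Kernel.const_apply,
      countKernel_apply, hfib] using this
  · have e1 := Measure.integral_compProd hint
    simp only [Kernel.prodMkRight_apply, countKernel_apply, hfib] at e1
    rw [mixedMoment, ← e1, h.isPoisson.prod_compProd_countKernel,
      integral_map hins.aemeasurable hF.aestronglyMeasurable, integral_congr_ae hae]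
    have e2 := integral_map (μ := (π.prod (Measure.pi fun _ => σ)).prod σ)
      mp.measurable.aemeasurable (f := fun z => ∑ r ∈ Finset.range (i + 1), G r z)
      (by rw [mp.map_eq]; exact hGs.1)
    rw [mp.map_eq] at e2
    rw [← e2, integral_finsetSum _ hG]
    refine Finset.sum_congr rfl fun r _ => ?_
    simp only [G]
    rw [integral_const_mul]
    rfl

theorem integrable_mixed (i : ℕ) {n : ℕ} (k : Fin n → ℕ) (hk : ∀ p, 1 ≤ k p)
    (hs : ∑ p, k p + i ≤ N + 1) :
    Integrable (fun z : Configuration X × (Fin n → X) =>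
      shiftProd (powProcess u k) Finset.univ z.1 z.2 * shiftedIntegral u z.1 z.2 ^ i)
      (π.prod (Measure.pi fun _ => σ)) := by
  induction i using Nat.strong_induction_on generalizing n with
  | _ i ih =>
  rcases i with _ | i
  · simp only [pow_zero, mul_one]
    exact ⟨(measurable_shiftProd_pow h.measurable k _).aestronglyMeasurable,
      h.jointAbsMoment_lt_top k hk hs⟩
  · refine (h.mixedMoment_succ_aux k i fun r hr => ?_).1
    rw [Finset.mem_range] at hr
    -- The total degree is conserved: `(r + 1) + (i - r) = i + 1`.
    refine ih (i - r) (by omega) _ (fun p => ?_) ?_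
    · cases p using Fin.cases with
      | zero => simp
      | succ p => simpa using hk p
    · rw [Fin.sum_cons]; omega

theorem mixedMoment_zero {n : ℕ} (k : Fin n → ℕ) :
    mixedMoment σ π u k 0 = jointMoment σ π u k := by
  simp [mixedMoment, jointMoment]

theorem mixedMoment_succ {n : ℕ} (k : Fin n → ℕ) (i : ℕ) (hk : ∀ p, 1 ≤ k p)
    (hs : ∑ p, k p + (i + 1) ≤ N + 1) :
    mixedMoment σ π u k (i + 1) = ∑ r ∈ Finset.range (i + 1), (i.choose r : ℝ) *
      mixedMoment σ π u (Fin.cons (r + 1) k : Fin (n + 1) → ℕ) (i - r) := by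
  refine (h.mixedMoment_succ_aux k i fun r hr => ?_).2
  rw [Finset.mem_range] at hr
  refine h.integrable_mixed (i - r) _ (fun p => ?_) ?_
  · cases p using Fin.cases with
    | zero => simp
    | succ p => simpa using hk p
  · rw [Fin.sum_cons]; omega

end IsMomentProcess

end

/-! ### Sums over set partitions and their binomial transforms. -/

section

section Tuples

open Finset.Nat (antidiagonalTuple mem_antidiagonalTuple)

theorem sum_antidiagonalTuple_succ {M : Type*} [AddCommMonoid M] (a n : ℕ)
    (f : (Fin (a + 1) → ℕ) → M) :
    ∑ l ∈ antidiagonalTuple (a + 1) n, f l =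
      ∑ r ∈ Finset.range (n + 1), ∑ l ∈ antidiagonalTuple a (n - r), f (Fin.cons r l) := by
  rw [Finset.sum_sigma']
  refine Finset.sum_bij' (fun l _ => ⟨l 0, Fin.tail l⟩) (fun x _ => Fin.cons x.1 x.2)
    ?_ ?_ ?_ ?_ ?_
  · intro l hl
    rw [mem_antidiagonalTuple, Fin.sum_univ_succ] at hl
    simp only [Finset.mem_sigma, Finset.mem_range, mem_antidiagonalTuple, Fin.tail]
    omega
  · rintro ⟨r, l⟩ hx
    simp only [Finset.mem_sigma, Finset.mem_range, mem_antidiagonalTuple] at hx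
    rw [mem_antidiagonalTuple, Fin.sum_cons]
    dsimp only
    omega
  · intro l _; exact Fin.cons_self_tail l
  · rintro ⟨r, l⟩ _; simp
  · intro l _; rw [Fin.cons_self_tail]

theorem sum_antidiagonalTuple_comp_perm {M : Type*} [AddCommMonoid M] {a : ℕ} (n : ℕ)
    (e : Equiv.Perm (Fin a)) (f : (Fin a → ℕ) → M) :
    ∑ l ∈ antidiagonalTuple a n, f (l ∘ e) = ∑ l ∈ antidiagonalTuple a n, f l := by
  refine Finset.sum_bij' (fun l _ => l ∘ e) (fun l _ => l ∘ e.symm) ?_ ?_ ?_ ?_ ?_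
  · intro l hl
    rw [mem_antidiagonalTuple] at hl ⊢
    rw [← hl]; exact Equiv.sum_comp e l
  · intro l hl
    rw [mem_antidiagonalTuple] at hl ⊢
    rw [← hl]; exact Equiv.sum_comp e.symm l
  · intro l _; ext i; simp
  · intro l _; ext i; simp
  · intro l _; rfl

/-- A symmetric weight times the total size equals a multiple of the weight of the first block. -/
theorem sum_mul_symmetric {a n : ℕ} (F : (Fin (a + 1) → ℕ) → ℝ)
    (hF : ∀ (e : Equiv.Perm (Fin (a + 1))) l, F (l ∘ e) = F l) :
    ((n + a + 1 : ℕ) : ℝ) * ∑ l ∈ antidiagonalTuple (a + 1) n, F l =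
      ((a + 1 : ℕ) : ℝ) * ∑ l ∈ antidiagonalTuple (a + 1) n, ((l 0 + 1 : ℕ) : ℝ) * F l := by
  -- Here `n + a + 1` is the sum of the `a + 1` block sizes `l p + 1`; by symmetry every block
  -- contributes as much as the first.
  have h1 : ∀ l ∈ antidiagonalTuple (a + 1) n, ((n + a + 1 : ℕ) : ℝ) * F l =
      ∑ p, ((l p + 1 : ℕ) : ℝ) * F l := by
    intro l hl
    rw [mem_antidiagonalTuple] at hl
    rw [← Finset.sum_mul, ← Nat.cast_sum, Finset.sum_add_distrib, hl]
    simp [add_assoc]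
  rw [Finset.mul_sum, Finset.sum_congr rfl h1, Finset.sum_comm]
  have h2 : ∀ p : Fin (a + 1), ∑ l ∈ antidiagonalTuple (a + 1) n, ((l p + 1 : ℕ) : ℝ) * F l =
      ∑ l ∈ antidiagonalTuple (a + 1) n, ((l 0 + 1 : ℕ) : ℝ) * F l := by
    intro p
    rw [← sum_antidiagonalTuple_comp_perm n (Equiv.swap 0 p)
      (fun l => ((l 0 + 1 : ℕ) : ℝ) * F l)]
    refine Finset.sum_congr rfl fun l _ => ?_
    rw [hF, Function.comp_apply, Equiv.swap_apply_left]
  rw [Finset.sum_congr rfl fun p _ => h2 p]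
  simp

theorem map_univ_comp_perm {a : ℕ} (f : Fin a → ℕ) (e : Equiv.Perm (Fin a)) :
    (Finset.univ.val.map fun p => f (e p)) = Finset.univ.val.map f := by
  have : (Finset.univ : Finset (Fin a)).map e.toEmbedding = Finset.univ := by simp
  conv_rhs => rw [← this]
  rw [Finset.map_val, Multiset.map_map]
  rfl

theorem map_univ_fin_cons {a : ℕ} (r : ℕ) (l : Fin a → ℕ) :
    (Finset.univ.val.map (Fin.cons r l : Fin (a + 1) → ℕ)) = r ::ₘ Finset.univ.val.map l := by
  rw [Fin.univ_succ, Finset.cons_val, Multiset.map_cons, Finset.map_val, Multiset.map_map]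
  congr 1

/-- The multiset `{1 + l_1, …, 1 + l_a}`. -/
def succMultiset {a : ℕ} (l : Fin a → ℕ) : Multiset ℕ := Finset.univ.val.map fun p => 1 + l p

theorem succMultiset_cons {a : ℕ} (r : ℕ) (l : Fin a → ℕ) :
    succMultiset (Fin.cons r l : Fin (a + 1) → ℕ) = (1 + r) ::ₘ succMultiset l := by
  rw [succMultiset, succMultiset, ← map_univ_fin_cons]
  congr 1
  ext p
  cases p using Fin.cases <;> simp

/-- `1 / (a! ∏_p (1 + l_p)!)`. -/
def blockWeight {a : ℕ} (l : Fin a → ℕ) : ℝ :=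
  ((a ! : ℝ) * ∏ p, ((1 + l p)! : ℝ))⁻¹

/-- The sum over the partitions of `i` elements into blocks of a function of the multiset of
block sizes. -/
def partitionSum (Ψ : Multiset ℕ → ℝ) (i : ℕ) : ℝ :=
  ∑ a ∈ Finset.range (i + 1), ∑ l ∈ antidiagonalTuple a (i - a),
    (i ! : ℝ) * blockWeight l * Ψ (succMultiset l)

theorem partitionSum_zero (Ψ : Multiset ℕ → ℝ) : partitionSum Ψ 0 = Ψ 0 := by
  simp [partitionSum, blockWeight, succMultiset]

/-- Classification by the block of a distinguished element: its `r` companions are chosen among `i`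
elements and the other `i - r` are partitioned freely. In terms of ordered tuples,
`sum_mul_symmetric` moves the distinguished element to the first block. -/
theorem partitionSum_succ (Ψ : Multiset ℕ → ℝ) (i : ℕ) :
    partitionSum Ψ (i + 1) = ∑ r ∈ Finset.range (i + 1),
      (i.choose r : ℝ) * partitionSum (fun m => Ψ ((r + 1) ::ₘ m)) (i - r) := by
  have h1 : ∀ a ∈ Finset.range (i + 1),
      ∑ l ∈ antidiagonalTuple (a + 1) (i + 1 - (a + 1)),
        ((i + 1)! : ℝ) * blockWeight l * Ψ (succMultiset l) =
      ∑ r ∈ Finset.range (i - a + 1), ∑ l ∈ antidiagonalTuple a (i - r - a),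
        (i.choose r : ℝ) * (((i - r)! : ℝ) * blockWeight l * Ψ ((r + 1) ::ₘ succMultiset l)) := by
    intro a ha
    rw [Finset.mem_range] at ha
    have e0 : i + 1 - (a + 1) = i - a := by omega
    have e1 : i - a + a + 1 = i + 1 := by omega
    have hs := sum_mul_symmetric (a := a) (n := i - a)
      (fun l => blockWeight l * Ψ (succMultiset l)) (fun e l => by
        have p1 : ∏ p, ((1 + (l ∘ e) p)! : ℝ) = ∏ p, ((1 + l p)! : ℝ) :=
          Equiv.prod_comp e fun p => ((1 + l p)! : ℝ)
        rw [blockWeight, blockWeight, p1]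
        congr 2
        exact map_univ_comp_perm (fun p => 1 + l p) e)
    rw [e1] at hs
    rw [e0]
    have hfac : ((i + 1)! : ℝ) = (i ! : ℝ) * ((i + 1 : ℕ) : ℝ) := by
      rw [Nat.factorial_succ]; push_cast; ring
    have h3 : ∑ l ∈ antidiagonalTuple (a + 1) (i - a),
        ((i + 1)! : ℝ) * blockWeight l * Ψ (succMultiset l) =
        (i ! : ℝ) * (((a + 1 : ℕ) : ℝ) * ∑ l ∈ antidiagonalTuple (a + 1) (i - a),
          ((l 0 + 1 : ℕ) : ℝ) * (blockWeight l * Ψ (succMultiset l))) := by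
      rw [← hs, Finset.mul_sum, Finset.mul_sum, hfac]
      exact Finset.sum_congr rfl fun l _ => by ring
    rw [h3, sum_antidiagonalTuple_succ, Finset.mul_sum, Finset.mul_sum]
    refine Finset.sum_congr rfl fun r hr => ?_
    rw [Finset.mem_range] at hr
    have e2 : i - a - r = i - r - a := by omega
    rw [e2, Finset.mul_sum, Finset.mul_sum]
    refine Finset.sum_congr rfl fun l _ => ?_
    rw [succMultiset_cons, Fin.cons_zero, add_comm 1 r]
    have hw : (i ! : ℝ) * (((a + 1 : ℕ) : ℝ) * (((r + 1 : ℕ) : ℝ) *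
        blockWeight (Fin.cons r l : Fin (a + 1) → ℕ))) =
        (i.choose r : ℝ) * ((i - r)! : ℝ) * blockWeight l := by
      have hc : (i.choose r : ℝ) * (r ! : ℝ) * ((i - r)! : ℝ) = (i ! : ℝ) := by
        exact_mod_cast Nat.choose_mul_factorial_mul_factorial (by omega : r ≤ i)
      rw [← hc, blockWeight, blockWeight, Fin.prod_univ_succ]
      simp only [Fin.cons_zero, Fin.cons_succ]
      rw [add_comm 1 r, Nat.factorial_succ r, Nat.factorial_succ a]
      push_cast
      have h5 : ∏ p, ((1 + l p)! : ℝ) ≠ 0 :=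
        Finset.prod_ne_zero_iff.2 fun p _ => by positivity
      field_simp
    calc _ = (i ! : ℝ) * (((a + 1 : ℕ) : ℝ) * (((r + 1 : ℕ) : ℝ) *
        blockWeight (Fin.cons r l : Fin (a + 1) → ℕ))) * Ψ ((r + 1) ::ₘ succMultiset l) := by ring
      _ = _ := by rw [hw]; ring
  -- The term without blocks drops out, as a positive number of elements cannot be partitioned into
  -- none.
  rw [partitionSum, Finset.sum_range_succ']
  simp only [Nat.sub_zero, Finset.Nat.antidiagonalTuple_zero_succ, Finset.sum_empty, add_zero]
  rw [Finset.sum_congr rfl h1]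
  simp only [partitionSum, Finset.mul_sum]
  refine Finset.sum_comm' fun a r => ?_
  simp only [Finset.mem_range]
  omega

/-- The binomial transform of `partitionSum`. -/
def centeredSum (c : ℝ) (Ψ : Multiset ℕ → ℝ) (m : ℕ) : ℝ :=
  ∑ i ∈ Finset.range (m + 1), (m.choose i : ℝ) * (-c) ^ (m - i) * partitionSum Ψ i

theorem centeredSum_add_mul (c x : ℝ) (Ψ Ψ' : Multiset ℕ → ℝ) (m : ℕ) :
    centeredSum c (fun s => x * Ψ s + Ψ' s) m = x * centeredSum c Ψ m + centeredSum c Ψ' m := by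
  simp only [centeredSum, partitionSum, Finset.mul_sum]
  rw [← Finset.sum_add_distrib]
  refine Finset.sum_congr rfl fun i _ => ?_
  rw [← Finset.sum_add_distrib]
  refine Finset.sum_congr rfl fun a _ => ?_
  rw [← Finset.sum_add_distrib]
  exact Finset.sum_congr rfl fun l _ => by ring

/-- When `partitionSum` gives the moments of `S`, the left side is `E[S (S - c)^n]`. The right side
sorts by the size `r + 1` of the block of the distinguished factor. -/
theorem sum_choose_mul_partitionSum_succ (c : ℝ) (Φ : Multiset ℕ → ℝ) (n : ℕ) :
    ∑ i ∈ Finset.range (n + 1), (n.choose i : ℝ) * (-c) ^ (n - i) * partitionSum Φ (i + 1) =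
      ∑ r ∈ Finset.range (n + 1),
        (n.choose r : ℝ) * centeredSum c (fun m => Φ ((r + 1) ::ₘ m)) (n - r) := by
  simp only [partitionSum_succ, centeredSum, Finset.mul_sum]
  rw [Finset.sum_sigma', Finset.sum_sigma']
  refine Finset.sum_bij' (fun x _ => ⟨x.2, x.1 - x.2⟩) (fun x _ => ⟨x.1 + x.2, x.1⟩)
    ?_ ?_ ?_ ?_ ?_
  · rintro ⟨i, r⟩ h
    simp only [Finset.mem_sigma, Finset.mem_range] at h ⊢
    omega
  · rintro ⟨r, i⟩ h
    simp only [Finset.mem_sigma, Finset.mem_range] at h ⊢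
    omega
  · rintro ⟨i, r⟩ h
    simp only [Finset.mem_sigma, Finset.mem_range] at h ⊢
    have : r + (i - r) = i := by omega
    rw [this]
  · rintro ⟨r, i⟩ h
    simp
  · rintro ⟨i, r⟩ h
    simp only [Finset.mem_sigma, Finset.mem_range] at h ⊢
    have e1 : n - r - (i - r) = n - i := by omega
    have e2 : (n.choose i : ℝ) * (i.choose r : ℝ) =
        (n.choose r : ℝ) * ((n - r).choose (i - r) : ℝ) := by
      exact_mod_cast Nat.choose_mul (by omega : r ≤ i)
    rw [e1]
    linear_combination (-c) ^ (n - i) *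
      partitionSum (fun m => Φ ((r + 1) ::ₘ m)) (i - r) * e2

theorem coeffC_cons (n a c r : ℕ) (l : Fin a → ℕ) :
    coeffC n a c (Fin.cons r l : Fin (a + 1) → ℕ) =
      (-1) ^ c * (n.choose r : ℝ) * (((∑ p, l p) + a + c)! : ℝ) / (c ! : ℝ) * blockWeight l := by
  simp only [coeffC, blockWeight, Fin.cons_zero, Fin.cons_succ]
  rw [div_eq_mul_inv, div_eq_mul_inv, mul_inv, mul_inv, mul_inv]
  ring

theorem sum_choose_mul_centeredSum (c : ℝ) (Ψ : ℕ → Multiset ℕ → ℝ) (n : ℕ) :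
    ∑ r ∈ Finset.range (n + 1), (n.choose r : ℝ) * centeredSum c (Ψ (r + 1)) (n - r) =
      ∑ a ∈ Finset.range (n + 1), ∑ b ∈ Finset.Icc a n, ∑ r ∈ Finset.range (n - b + 1),
        ∑ l ∈ antidiagonalTuple a (n - b - r),
          coeffC n a (b - a) (Fin.cons r l : Fin (a + 1) → ℕ) * c ^ (b - a) *
            Ψ (1 + r) (succMultiset l) := by
  simp only [centeredSum, partitionSum, Finset.mul_sum (s := Finset.range _)]
  rw [Finset.sum_sigma', Finset.sum_sigma', Finset.sum_sigma', Finset.sum_sigma']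
  -- Of the `n - r` factors outside the distinguished block, `i` form `a` blocks and `n - r - i`
  -- contribute `-c`; so `b - a = n - r - i`.
  refine Finset.sum_bij' (fun x _ => ⟨⟨x.2, n - x.1.1 - x.1.2 + x.2⟩, x.1.1⟩)
    (fun x _ => ⟨⟨x.2, n - x.1.2 - x.2 + x.1.1⟩, x.1.1⟩) ?_ ?_ ?_ ?_ ?_
  · rintro ⟨⟨r, i⟩, a⟩ h
    simp only [Finset.mem_sigma, Finset.mem_range, Finset.mem_Icc] at h ⊢
    omega
  · rintro ⟨⟨a, b⟩, r⟩ h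
    simp only [Finset.mem_sigma, Finset.mem_range, Finset.mem_Icc] at h ⊢
    omega
  · rintro ⟨⟨r, i⟩, a⟩ h
    simp only [Finset.mem_sigma, Finset.mem_range] at h ⊢
    have : n - (n - r - i + a) - r + a = i := by omega
    rw [this]
  · rintro ⟨⟨a, b⟩, r⟩ h
    simp only [Finset.mem_sigma, Finset.mem_range, Finset.mem_Icc] at h ⊢
    have : n - r - (n - b - r + a) + a = b := by omega
    rw [this]
  · rintro ⟨⟨r, i⟩, a⟩ h
    simp only [Finset.mem_sigma, Finset.mem_range] at h ⊢
    have e1 : n - (n - r - i + a) - r = i - a := by omega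
    have e2 : n - r - i + a - a = n - r - i := by omega
    rw [e1, e2, Finset.mul_sum, Finset.mul_sum]
    refine Finset.sum_congr rfl fun l hl => ?_
    rw [mem_antidiagonalTuple] at hl
    have e3 : ∑ p, l p + a + (n - r - i) = n - r := by omega
    have hc : ((n - r).choose i : ℝ) * (i ! : ℝ) = ((n - r)! : ℝ) / ((n - r - i)! : ℝ) := by
      rw [eq_div_iff (by positivity)]
      exact_mod_cast Nat.choose_mul_factorial_mul_factorial (by omega : i ≤ n - r)
    rw [coeffC_cons, e3, add_comm 1 r, neg_pow c]
    linear_combination (n.choose r : ℝ) * (-1) ^ (n - r - i) * c ^ (n - r - i) *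
      blockWeight l * Ψ (r + 1) (succMultiset l) * hc

end Tuples

end

/-! ### Expansion of joint moments over index sets containing the distinguished block. -/

section

open Finset.Nat (antidiagonalTuple mem_antidiagonalTuple)

theorem sum_powerset_map {ι κ M : Type*} [AddCommMonoid M] (e : κ ↪ ι)
    (S : Finset κ) (f : Finset ι → M) :
    ∑ T ∈ (S.map e).powerset, f T = ∑ T ∈ S.powerset, f (T.map e) := by
  refine (Finset.sum_bij (fun T _ => T.map e) ?_ ?_ ?_ ?_).symm
  · intro T hT
    rw [Finset.mem_powerset] at hT ⊢
    exact Finset.map_subset_map.2 hT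
  · intro T _ T' _ h
    exact Finset.map_injective e h
  · intro T hT
    rw [Finset.mem_powerset] at hT
    obtain ⟨T', hT', rfl⟩ := Finset.subset_map_iff.1 hT
    exact ⟨T', Finset.mem_powerset.2 hT', rfl⟩
  · intro T _; rfl

/-- The Möbius transform of `T ↦ Φ (k_T)` with weights `-H (k_i)`. -/
def subsetDelta (Φ : Multiset ℕ → ℝ) (H : ℕ → ℝ) {ι : Type*} [DecidableEq ι] (k : ι → ℕ)
    (S : Finset ι) : ℝ :=
  ∑ T ∈ S.powerset, (∏ i ∈ S \ T, -H (k i)) * Φ (T.val.map k)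

section

variable (Φ : Multiset ℕ → ℝ) (H : ℕ → ℝ)

theorem subsetDelta_map {ι κ : Type*} [DecidableEq ι] [DecidableEq κ] (e : κ ↪ ι) (k : ι → ℕ)
    (S : Finset κ) : subsetDelta Φ H k (S.map e) = subsetDelta Φ H (k ∘ e) S := by
  rw [subsetDelta, sum_powerset_map, subsetDelta]
  refine Finset.sum_congr rfl fun T _ => ?_
  rw [← Finset.map_sdiff, Finset.prod_map, Finset.map_val, Multiset.map_map]
  rfl

theorem sum_subsetDelta {ι : Type*} [DecidableEq ι] (k : ι → ℕ) (U : Finset ι) :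
    ∑ S ∈ U.powerset, (∏ i ∈ U \ S, H (k i)) * subsetDelta Φ H k S = Φ (U.val.map k) :=
  (sum_powerset_inversion (fun i => H (k i)) (f := subsetDelta Φ H k)
    (g := fun T => Φ (T.val.map k)) U fun _ _ => rfl).symm

/-- The summand of the expansion of `Φ (k₀ :: 1 + l)` attached to a set of indices of `l`. -/
def anchoredTerm (k₀ : ℕ) {a : ℕ} (l : Fin a → ℕ) (S : Finset (Fin a)) : ℝ :=
  (∏ i ∈ Finset.univ \ S, H (1 + l i)) *
    subsetDelta Φ H (Fin.cons k₀ fun i => 1 + l i : Fin (a + 1) → ℕ)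
      (insert 0 (S.map (Fin.succEmb a)))

/-- Expand `Φ` of the full list by `sum_subsetDelta`. The index sets avoiding `0` resum to `H k₀ * Φ
(succMultiset l)`, so the difference retains exactly those containing `0`. -/
theorem cons_sub_eq_sum_anchoredTerm (k₀ : ℕ) {a : ℕ} (l : Fin a → ℕ) :
    Φ (k₀ ::ₘ succMultiset l) - H k₀ * Φ (succMultiset l) =
      ∑ S : Finset (Fin a), anchoredTerm Φ H k₀ l S := by
  set k : Fin (a + 1) → ℕ := Fin.cons k₀ fun i => 1 + l i with hk
  have h0 : (0 : Fin (a + 1)) ∉ Finset.univ.map (Fin.succEmb a) := by simp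
  have hu : (Finset.univ : Finset (Fin (a + 1))) =
      insert 0 (Finset.univ.map (Fin.succEmb a)) := by
    rw [Fin.univ_succ, Finset.cons_eq_insert]
    rfl
  have h0S : ∀ S : Finset (Fin a), (0 : Fin (a + 1)) ∉ S.map (Fin.succEmb a) := fun S => by simp
  have h1 := sum_subsetDelta Φ H k Finset.univ
  rw [hk, map_univ_fin_cons, ← hk, hu, Finset.sum_powerset_insert h0, sum_powerset_map,
    sum_powerset_map] at h1
  change _ = Φ (k₀ ::ₘ succMultiset l) at h1
  rw [← h1, ← Finset.powerset_univ]
  have h2 : ∑ S ∈ (Finset.univ : Finset (Fin a)).powerset,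
      (∏ i ∈ insert 0 (Finset.univ.map (Fin.succEmb a)) \ S.map (Fin.succEmb a), H (k i)) *
        subsetDelta Φ H k (S.map (Fin.succEmb a)) = H k₀ * Φ (succMultiset l) := by
    have h3 := sum_subsetDelta Φ H (fun i => 1 + l i) Finset.univ
    change _ = Φ (succMultiset l) at h3
    rw [← h3, Finset.mul_sum]
    refine Finset.sum_congr rfl fun S _ => ?_
    rw [Finset.insert_sdiff_of_notMem _ (h0S S), ← Finset.map_sdiff,
      Finset.prod_insert (h0S _), Finset.prod_map, subsetDelta_map]
    simp only [hk, Fin.cons_zero, Fin.coe_succEmb, Fin.cons_succ, Function.comp_def]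
    ring
  rw [h2, add_sub_cancel_left]
  refine Finset.sum_congr rfl fun S _ => ?_
  rw [Finset.insert_sdiff_insert, Finset.sdiff_insert_of_notMem h0, ← Finset.map_sdiff,
    Finset.prod_map, anchoredTerm]
  simp only [hk, Fin.coe_succEmb, Fin.cons_succ]

theorem anchoredTerm_comp_perm (k₀ : ℕ) {a : ℕ} (l : Fin a → ℕ) (e : Equiv.Perm (Fin a))
    (S : Finset (Fin a)) :
    anchoredTerm Φ H k₀ (l ∘ e) S = anchoredTerm Φ H k₀ l (S.map e.toEmbedding) := by
  have hu : (Finset.univ : Finset (Fin a)) = Finset.univ.map e.toEmbedding := by simp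
  rw [anchoredTerm, anchoredTerm]
  congr 1
  · conv_rhs => rw [hu]
    rw [← Finset.map_sdiff, Finset.prod_map]
    rfl
  · let E : Fin (a + 1) ↪ Fin (a + 1) :=
      ⟨Fin.cons 0 fun i => (e i).succ, by
        intro i j hij
        cases i using Fin.cases <;> cases j using Fin.cases <;>
          simp_all [Fin.succ_ne_zero, (Fin.succ_ne_zero _).symm]⟩
    have h1 : insert 0 ((S.map e.toEmbedding).map (Fin.succEmb a)) =
        (insert 0 (S.map (Fin.succEmb a))).map E := by
      rw [Finset.map_insert, Finset.map_map, Finset.map_map]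
      rfl
    rw [h1, subsetDelta_map]
    congr 1
    ext i
    cases i using Fin.cases <;> rfl

/-- The first `j` indices. -/
def initialIndices (a j : ℕ) : Finset (Fin a) := Finset.univ.filter fun i => (i : ℕ) < j

theorem card_initialIndices {a j : ℕ} (h : j ≤ a) : (initialIndices a j).card = j := by
  rw [initialIndices, Fin.card_filter_val_lt, min_eq_right h]

/-- A permutation carries any `S` of size `j` to the initial segment of that size, and the symmetric
sum over `l` absorbs it; `a.choose j` counts the sets `S`. -/
theorem sum_symmetric_mul_anchoredTerm (k₀ : ℕ) {a : ℕ} (m : ℕ) (w : (Fin a → ℕ) → ℝ)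
    (hw : ∀ (e : Equiv.Perm (Fin a)) l, w (l ∘ e) = w l) :
    ∑ l ∈ antidiagonalTuple a m, w l * ∑ S, anchoredTerm Φ H k₀ l S =
      ∑ j ∈ Finset.range (a + 1), ∑ l ∈ antidiagonalTuple a m,
        (a.choose j : ℝ) * (w l * anchoredTerm Φ H k₀ l (initialIndices a j)) := by
  have h1 : ∀ j ∈ Finset.range (a + 1), ∀ S ∈ Finset.powersetCard j (Finset.univ : Finset (Fin a)),
      ∑ l ∈ antidiagonalTuple a m, w l * anchoredTerm Φ H k₀ l S =
        ∑ l ∈ antidiagonalTuple a m, w l * anchoredTerm Φ H k₀ l (initialIndices a j) := by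
    intro j hj S hS
    rw [Finset.mem_range] at hj
    have hc : (initialIndices a j).card = S.card := by
      rw [card_initialIndices (by omega), (Finset.mem_powersetCard.1 hS).2]
    obtain ⟨e, he⟩ : ∃ e : Equiv.Perm (Fin a), (initialIndices a j).map e.toEmbedding = S := by
      have hcs : Fintype.card {x // x ∈ initialIndices a j} = Fintype.card {x // x ∈ S} := by
        simpa using hc
      let f := Fintype.equivOfCardEq hcs
      refine ⟨f.extendSubtype, ?_⟩
      refine Finset.eq_of_subset_of_card_le ?_ (by rw [Finset.card_map, hc])
      intro x hx
      obtain ⟨y, hy, rfl⟩ := Finset.mem_map.1 hx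
      exact f.extendSubtype_mem y hy
    rw [← sum_antidiagonalTuple_comp_perm m e fun l =>
      w l * anchoredTerm Φ H k₀ l (initialIndices a j)]
    refine Finset.sum_congr rfl fun l _ => ?_
    rw [hw, anchoredTerm_comp_perm, he]
  simp_rw [Finset.mul_sum]
  rw [Finset.sum_comm, ← Finset.powerset_univ, Finset.sum_powerset]
  simp only [Finset.card_univ, Fintype.card_fin]
  refine Finset.sum_congr rfl fun j hj => ?_
  rw [Finset.sum_congr rfl (h1 j hj), Finset.sum_const, Finset.card_powersetCard]
  simp [Finset.mul_sum]

/-- Index `i` of `l` sits at position `i + 1` of `Fin.cons r l`, so the indices outside the initial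
segment become the positions `j + 1, …, a`. -/
theorem anchoredTerm_initialIndices (r : ℕ) {a j : ℕ} (hj : j ≤ a) (l : Fin a → ℕ) :
    anchoredTerm Φ H (1 + r) l (initialIndices a j) =
      (∏ q ∈ Finset.Icc (j + 1) a, H (1 + extendZero (Fin.cons r l : Fin (a + 1) → ℕ) q)) *
        subsetDelta Φ H
          (fun p : Fin (j + 1) => 1 + extendZero (Fin.cons r l : Fin (a + 1) → ℕ) p)
          Finset.univ := by
  have hext : ∀ i : Fin (a + 1), extendZero (Fin.cons r l : Fin (a + 1) → ℕ) i =
      (Fin.cons r l : Fin (a + 1) → ℕ) i := fun i => by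
    rw [extendZero, dif_pos i.2]
  rw [anchoredTerm]
  congr 1
  · refine Finset.prod_bij (fun i _ => (i : ℕ) + 1) ?_ ?_ ?_ ?_
    · intro i hi
      simp only [initialIndices, Finset.mem_sdiff, Finset.mem_univ, Finset.mem_filter, true_and,
        not_lt] at hi
      rw [Finset.mem_Icc]
      omega
    · intro i _ i' _ h
      exact Fin.ext (by omega)
    · intro q hq
      rw [Finset.mem_Icc] at hq
      refine ⟨⟨q - 1, by omega⟩, ?_, by simp only; omega⟩
      simp only [initialIndices, Finset.mem_sdiff, Finset.mem_univ, Finset.mem_filter, true_and,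
        not_lt]
      omega
    · intro i _
      have := hext i.succ
      rw [Fin.val_succ, Fin.cons_succ] at this
      rw [this]
  · have hS : insert 0 ((initialIndices a j).map (Fin.succEmb a)) =
        Finset.univ.map (Fin.castLEEmb (by omega : j + 1 ≤ a + 1)) := by
      ext i
      simp only [initialIndices, Finset.mem_insert, Finset.mem_map, Finset.mem_filter,
        Finset.mem_univ, true_and, Fin.coe_succEmb, Fin.coe_castLEEmb]
      constructor
      · rintro (rfl | ⟨i, hi, rfl⟩)
        · exact ⟨0, rfl⟩
        · exact ⟨⟨i + 1, by omega⟩, by ext; simp⟩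
      · rintro ⟨p, rfl⟩
        cases p using Fin.cases with
        | zero => left; rfl
        | succ p => right; exact ⟨⟨p, by omega⟩, p.2, by ext; simp⟩
    rw [hS, subsetDelta_map]
    congr 1
    ext p
    have := hext (Fin.castLE (by omega : j + 1 ≤ a + 1) p)
    rw [Fin.val_castLE] at this
    rw [this]
    cases p using Fin.cases with
    | zero => rfl
    | succ p => rfl

/-- The padding zeros let the `b - a` factors `H 1` that come from centering be written as the tail
of a single product. -/
theorem prod_Icc_extendZero {a b j : ℕ} (hj : j ≤ a) (hb : a ≤ b) (l : Fin (a + 1) → ℕ) :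
    ∏ q ∈ Finset.Icc (j + 1) b, H (1 + extendZero l q) =
      H 1 ^ (b - a) * ∏ q ∈ Finset.Icc (j + 1) a, H (1 + extendZero l q) := by
  obtain ⟨c, rfl⟩ := Nat.exists_eq_add_of_le hb
  induction c with
  | zero => simp
  | succ c ih =>
    rw [← add_assoc, Finset.prod_Icc_succ_top (by omega), ih (by omega)]
    have : extendZero l (a + c + 1) = 0 := by rw [extendZero, dif_neg (by omega)]
    have e1 : a + c - a = c := by omega
    have e2 : a + c + 1 - a = c + 1 := by omega
    rw [this, e1, e2]
    ring

theorem blockWeight_comp_perm {a : ℕ} (l : Fin a → ℕ) (e : Equiv.Perm (Fin a)) :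
    blockWeight (l ∘ e) = blockWeight l := by
  rw [blockWeight, blockWeight]
  congr 2
  exact Equiv.prod_comp e fun p => ((1 + l p)! : ℝ)

/-- The combinatorial form of the recursion for the centered moments. -/
theorem centered_expansion (n : ℕ) :
    ∑ i ∈ Finset.range (n + 1), (n.choose i : ℝ) * (-H 1) ^ (n - i) * partitionSum Φ (i + 1) =
      ∑ k ∈ Finset.range (n + 1),
        (n.choose k : ℝ) * H (n - k + 1) * centeredSum (H 1) Φ k +
      ∑ a ∈ Finset.range (n + 1), ∑ j ∈ Finset.range (a + 1), ∑ b ∈ Finset.Icc a n,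
        ∑ l ∈ antidiagonalTuple (a + 1) (n - b),
          (a.choose j : ℝ) * coeffC n a (b - a) l *
          (∏ q ∈ Finset.Icc (j + 1) b, H (1 + extendZero l q)) *
          subsetDelta Φ H (fun p : Fin (j + 1) => 1 + extendZero l p) Finset.univ := by
  rw [sum_choose_mul_partitionSum_succ]
  -- The distinguished block is split as `Φ (k ::ₘ m) = H k * Φ m + (Φ (k ::ₘ m) - H k * Φ m)`: the
  -- first part leads to lower moments, the second to `anchoredTerm`.
  have h1 : ∀ r, centeredSum (H 1) (fun m => Φ ((r + 1) ::ₘ m)) (n - r) =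
      H (r + 1) * centeredSum (H 1) Φ (n - r) + centeredSum (H 1)
        ((fun k m => Φ (k ::ₘ m) - H k * Φ m) (r + 1)) (n - r) := by
    intro r
    rw [← centeredSum_add_mul]
    congr 1
    ext m
    ring
  simp_rw [h1, mul_add]
  rw [Finset.sum_add_distrib, sum_choose_mul_centeredSum (H 1)
    (fun k m => Φ (k ::ₘ m) - H k * Φ m) n]
  congr 1
  -- The substitution `k = n - r` counts the factors outside the distinguished block.
  · rw [← Finset.sum_range_reflect]
    refine Finset.sum_congr rfl fun k hk => ?_
    rw [Finset.mem_range] at hk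
    have e1 : n + 1 - 1 - k = n - k := by omega
    have e2 : n - (n - k) = k := by omega
    rw [e1, e2, Nat.choose_symm (by omega)]
    ring
  · refine Finset.sum_congr rfl fun a ha => ?_
    rw [Finset.sum_comm]
    refine Finset.sum_congr rfl fun b hb => ?_
    rw [Finset.mem_Icc] at hb
    simp_rw [sum_antidiagonalTuple_succ]
    rw [Finset.sum_comm (s := Finset.range (a + 1))]
    refine Finset.sum_congr rfl fun r hr => ?_
    simp_rw [cons_sub_eq_sum_anchoredTerm]
    rw [sum_symmetric_mul_anchoredTerm Φ H (1 + r) (n - b - r) (fun l =>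
      coeffC n a (b - a) (Fin.cons r l : Fin (a + 1) → ℕ) * H 1 ^ (b - a))]
    · refine Finset.sum_congr rfl fun j hj => Finset.sum_congr rfl fun l _ => ?_
      rw [Finset.mem_range] at hj
      rw [anchoredTerm_initialIndices _ _ _ (by omega), prod_Icc_extendZero _ (by omega) hb.1]
      ring
    · intro e l
      have hs : ∑ p, (l ∘ e) p = ∑ p, l p := Equiv.sum_comp e l
      rw [coeffC_cons, coeffC_cons, blockWeight_comp_perm, hs]

end

end

/-! ### Moments of the Poisson-Skorohod integral. -/

section

open PoissonInvariance.Configuration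

theorem exists_equiv_of_map_eq {ι κ : Type*} [Fintype ι] [Fintype κ] {f : ι → ℕ} {g : κ → ℕ}
    (h : (Finset.univ.val.map f) = Finset.univ.val.map g) :
    ∃ e : ι ≃ κ, ∀ i, g (e i) = f i := by
  classical
  have hc : ∀ n, Fintype.card {i // f i = n} = Fintype.card {i // g i = n} := by
    intro n
    have := congrArg (Multiset.count n) h
    rw [Multiset.count_map, Multiset.count_map] at this
    rw [Fintype.card_subtype, Fintype.card_subtype, Finset.card, Finset.card, Finset.filter_val,
      Finset.filter_val]
    simpa only [eq_comm] using this
  let e : ∀ n, {i // f i = n} ≃ {i // g i = n} := fun n => Fintype.equivOfCardEq (hc n)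
  refine ⟨(Equiv.sigmaFiberEquiv f).symm.trans
    ((Equiv.sigmaCongrRight e).trans (Equiv.sigmaFiberEquiv g)), fun i => ?_⟩
  exact (e (f i) ⟨i, rfl⟩).2

/-- The analogue of `(S - c)^{n+1} = S (S - c)^n - c (S - c)^n`, by Pascal's rule. -/
theorem centeredSum_succ (c : ℝ) (Φ : Multiset ℕ → ℝ) (n : ℕ) :
    centeredSum c Φ (n + 1) = ∑ i ∈ Finset.range (n + 1), (n.choose i : ℝ) * (-c) ^ (n - i) *
      partitionSum Φ (i + 1) - c * centeredSum c Φ n := by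
  have h1 : -c * centeredSum c Φ n = ∑ i ∈ Finset.range (n + 1 + 1),
      (n.choose i : ℝ) * (-c) ^ (n + 1 - i) * partitionSum Φ i := by
    rw [Finset.sum_range_succ, Nat.choose_succ_self, centeredSum, Finset.mul_sum]
    simp only [Nat.cast_zero, zero_mul, add_zero]
    refine Finset.sum_congr rfl fun i hi => ?_
    rw [Finset.mem_range] at hi
    rw [Nat.succ_sub (by omega : i ≤ n), pow_succ]
    ring
  rw [sub_eq_add_neg, ← neg_mul, h1, centeredSum, Finset.sum_range_succ',
    Finset.sum_range_succ' (n := n + 1), ← add_assoc, ← Finset.sum_add_distrib]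
  congr 1
  · refine Finset.sum_congr rfl fun i _ => ?_
    rw [Nat.choose_succ_succ, Nat.add_sub_add_right]
    push_cast
    ring
  · simp

/-- The value of `jointMoment` as a function of the multiset of exponents. -/
def multisetMoment {X : Type*} [TopologicalSpace X] [MeasurableSpace X] (σ : Measure X)
    (π : Measure (Configuration X)) (u : Configuration X → X → ℝ) (m : Multiset ℕ) : ℝ :=
  jointMoment σ π u fun i : Fin m.toList.length => m.toList.get i

namespace IsMomentProcess

variable {X : Type*} [MetricSpace X] [SigmaCompactSpace X] [MeasurableSpace X] [BorelSpace X]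
  {σ : Measure X} [SigmaFinite σ] [NullSingletonClass σ] {π : Measure (Configuration X)}
  {u : Configuration X → X → ℝ} {N : ℕ} {A : ℕ → ℝ≥0∞} {H : ℕ → ℝ}
  (h : IsMomentProcess σ π u N A H)
include h

/-- Joint moments are invariant under relabelling the variables, so the order chosen by `toList` is
immaterial. -/
theorem multisetMoment_map {ι : Type*} [Fintype ι] [DecidableEq ι] (k : ι → ℕ) :
    multisetMoment σ π u (Finset.univ.val.map k) = jointMoment σ π u k := by
  have := h.isPoisson.isProbabilityMeasure
  obtain ⟨e, he⟩ := exists_equiv_of_map_eq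
    (f := fun i : Fin (Finset.univ.val.map k).toList.length =>
      (Finset.univ.val.map k).toList.get i) (g := k) (by
      rw [Fin.univ_val_map, List.ofFn_get, Multiset.coe_toList])
  rw [← jointMoment_comp_equiv h.measurable e k, multisetMoment]
  simp only [he]

theorem integral_bigDelta_eq_subsetDelta {m : ℕ} (k : Fin m → ℕ) (hk : ∀ i, 1 ≤ k i)
    (hs : ∑ i, k i ≤ N + 1) :
    ∫ ω, ∫ s : Fin m → X, bigDelta (powProcess u k) s ω ∂(Measure.pi fun _ => σ) ∂π =
      subsetDelta (multisetMoment σ π u) H k Finset.univ := by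
  rw [h.integral_bigDelta k hk hs, subsetDelta, Finset.powerset_univ]
  refine Finset.sum_congr rfl fun S _ => ?_
  rw [← h.multisetMoment_map]
  congr 2
  exact Multiset.attach_map_val' S.val k

/-- Both sides obey the same recursion in `i`; the exponents `k` already created are carried along
unchanged. -/
theorem mixedMoment_eq_partitionSum (i : ℕ) {n : ℕ} (k : Fin n → ℕ) (hk : ∀ p, 1 ≤ k p)
    (hs : ∑ p, k p + i ≤ N + 1) :
    mixedMoment σ π u k i =
      partitionSum (fun m => multisetMoment σ π u (m + Finset.univ.val.map k)) i := by
  induction i using Nat.strong_induction_on generalizing n with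
  | _ i ih =>
  rcases i with _ | i
  · rw [h.mixedMoment_zero, partitionSum_zero, zero_add, h.multisetMoment_map]
  · rw [h.mixedMoment_succ k i hk hs, partitionSum_succ]
    refine Finset.sum_congr rfl fun r hr => ?_
    rw [Finset.mem_range] at hr
    rw [ih (i - r) (by omega) _ (fun p => ?_) (by rw [Fin.sum_cons]; omega)]
    · simp only [map_univ_fin_cons, Multiset.add_cons, Multiset.cons_add]
    · cases p using Fin.cases with
      | zero => simp
      | succ p => simpa using hk p

theorem integrable_integral_shiftedIntegral_pow (i : ℕ) (hi : i ≤ N + 1) :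
    Integrable (fun ω => shiftedIntegral u ω (Fin.elim0 : Fin 0 → X) ^ i) π ∧
    ∫ ω, shiftedIntegral u ω (Fin.elim0 : Fin 0 → X) ^ i ∂π =
      partitionSum (multisetMoment σ π u) i := by
  have := h.isPoisson.isProbabilityMeasure
  have hs : ∑ p, (Fin.elim0 : Fin 0 → ℕ) p + i ≤ N + 1 := by simpa using hi
  have hI := h.integrable_mixed i (Fin.elim0 : Fin 0 → ℕ) (fun p => p.elim0) hs
  have hP := h.mixedMoment_eq_partitionSum i (Fin.elim0 : Fin 0 → ℕ) (fun p => p.elim0) hs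
  -- With no added points the product measure is a Dirac mass, so mixed moments over `Fin 0` are
  -- plain expectations of powers.
  have mp : MeasurePreserving (fun ω : Configuration X => (ω, (Fin.elim0 : Fin 0 → X))) π
      (π.prod (Measure.pi fun _ => σ)) := by
    rw [Measure.pi_of_empty (fun _ : Fin 0 => σ) Fin.elim0]
    refine ⟨measurable_prodMk_right, ?_⟩
    rw [Measure.prod_dirac]
  have e : ∀ ω : Configuration X, shiftProd (powProcess u (Fin.elim0 : Fin 0 → ℕ)) Finset.univ ω
      (Fin.elim0 : Fin 0 → X) = 1 := fun ω => by simp [shiftProd]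
  constructor
  · have := (mp.integrable_comp hI.1).2 hI
    simpa only [Function.comp_def, e, one_mul] using this
  · have e2 := integral_map mp.measurable.aemeasurable
      (f := fun z : Configuration X × (Fin 0 → X) =>
      shiftProd (powProcess u (Fin.elim0 : Fin 0 → ℕ)) Finset.univ z.1 z.2 *
        shiftedIntegral u z.1 z.2 ^ i) (by rw [mp.map_eq]; exact hI.1)
    rw [mp.map_eq] at e2
    simp only [e, one_mul] at e2
    rw [← e2]
    refine hP.trans ?_
    simp

/-- Since `σ` is diffuse, `ω \ {t}` equals `ω` for `σ`-almost every `t`; the compensator is then the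
first moment of `u ω`, which is constant. -/
theorem skorohod_ae_eq :
    skorohod σ u =ᵐ[π] fun ω => shiftedIntegral u ω (Fin.elim0 : Fin 0 → X) - H 1 := by
  filter_upwards [h.hasMoments] with ω hω
  have h1 := (hω 1 le_rfl (by omega)).2
  simp only [pow_one] at h1
  have h2 : ∫ t, u (ω.erase t) t ∂σ = ∫ t, u ω t ∂σ := by
    refine integral_congr_ae ?_
    filter_upwards [Configuration.ae_notMem_carrier σ ω] with t ht
    rw [Configuration.erase_eq ht]
  rw [skorohod, h2, h1, shiftedIntegral]
  simp only [Finset.univ_eq_empty, Configuration.addPoints_empty]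

theorem memLp_skorohod (n : ℕ) (hn : n ≤ N) : MemLp (skorohod σ u) ((n : ℝ≥0∞) + 1) π := by
  have := h.isPoisson.isProbabilityMeasure
  have hs : Measurable fun ω : Configuration X => (ω, (Fin.elim0 : Fin 0 → X)) :=
    measurable_prodMk_right
  have hm := (measurable_shiftedIntegral h.measurable 0).comp hs
  simp only [Function.comp_def] at hm
  refine MemLp.ae_eq h.skorohod_ae_eq.symm (MemLp.sub ⟨hm.aestronglyMeasurable, ?_⟩
    (memLp_const _))
  have hI := (h.integrable_integral_shiftedIntegral_pow (n + 1) (by omega)).1.2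
  rw [HasFiniteIntegral] at hI
  simp only [enorm_pow] at hI
  rw [← eLpNorm_natCast_add_one] at hI
  exact (ENNReal.pow_lt_top_iff.1 hI).resolve_right (by omega)

theorem integral_skorohod_pow (m : ℕ) (hm : m ≤ N + 1) :
    ∫ ω, skorohod σ u ω ^ m ∂π = centeredSum (H 1) (multisetMoment σ π u) m := by
  have e : ∀ᵐ ω ∂π, skorohod σ u ω ^ m = ∑ i ∈ Finset.range (m + 1),
      (m.choose i : ℝ) * (-H 1) ^ (m - i) *
        shiftedIntegral u ω (Fin.elim0 : Fin 0 → X) ^ i := by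
    filter_upwards [h.skorohod_ae_eq] with ω hω
    rw [hω, sub_eq_add_neg, add_pow]
    exact Finset.sum_congr rfl fun i _ => by ring
  have hI : ∀ i ∈ Finset.range (m + 1), _ := fun i hi =>
    h.integrable_integral_shiftedIntegral_pow i (by rw [Finset.mem_range] at hi; omega)
  rw [integral_congr_ae e, integral_finsetSum _ fun i hi => (hI i hi).1.const_mul _, centeredSum]
  refine Finset.sum_congr rfl fun i hi => ?_
  rw [integral_const_mul, (hI i hi).2]

/-- The recursion for the moments of the Poisson-Skorohod integral. -/
theorem integral_skorohod_pow_succ (n : ℕ) (hn : n ≤ N) :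
    ∫ ω, skorohod σ u ω ^ (n + 1) ∂π =
      ∑ k ∈ Finset.range n,
        (n.choose k : ℝ) * H (n - k + 1) * ∫ ω, skorohod σ u ω ^ k ∂π +
      ∑ a ∈ Finset.range (n + 1), ∑ j ∈ Finset.range (a + 1), ∑ b ∈ Finset.Icc a n,
        ∑ l ∈ Finset.Nat.antidiagonalTuple (a + 1) (n - b),
          (a.choose j : ℝ) * coeffC n a (b - a) l *
          (∏ q ∈ Finset.Icc (j + 1) b, H (1 + extendZero l q)) *
          ∫ ω, ∫ s : Fin (j + 1) → X,
            bigDelta (powProcess u fun p : Fin (j + 1) => 1 + extendZero l p) s ω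
            ∂(Measure.pi fun _ => σ) ∂π := by
  have hΔ : ∀ a ∈ Finset.range (n + 1), ∀ j ∈ Finset.range (a + 1), ∀ b ∈ Finset.Icc a n,
      ∀ l ∈ Finset.Nat.antidiagonalTuple (a + 1) (n - b),
      ∫ ω, ∫ s : Fin (j + 1) → X,
        bigDelta (powProcess u fun p : Fin (j + 1) => 1 + extendZero l p) s ω
        ∂(Measure.pi fun _ => σ) ∂π = subsetDelta (multisetMoment σ π u) H
          (fun p : Fin (j + 1) => 1 + extendZero l p) Finset.univ := by
    intro a ha j hj b hb l hl
    rw [Finset.mem_range] at ha hj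
    rw [Finset.mem_Icc] at hb
    rw [Finset.Nat.mem_antidiagonalTuple] at hl
    -- The total exponent is at most `(j + 1) + (n - b) ≤ n + 1`, because `j ≤ a ≤ b`.
    refine h.integral_bigDelta_eq_subsetDelta _ (fun p => by omega) ?_
    rw [Finset.sum_add_distrib]
    have hsum : ∑ p : Fin (j + 1), extendZero l p ≤ n - b := by
      rw [← hl, Fin.sum_univ_eq_sum_range (fun q => extendZero l q) (j + 1)]
      refine (Finset.sum_le_sum_of_subset (Finset.range_mono (by omega : j + 1 ≤ a + 1))).trans
        (le_of_eq ?_)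
      rw [← Fin.sum_univ_eq_sum_range]
      exact Finset.sum_congr rfl fun i _ => by rw [extendZero, dif_pos i.2]
    simp only [Finset.sum_const, Finset.card_univ, Fintype.card_fin, smul_eq_mul]
    omega
  have hM : ∀ k ∈ Finset.range n, (n.choose k : ℝ) * H (n - k + 1) * ∫ ω, skorohod σ u ω ^ k ∂π =
      (n.choose k : ℝ) * H (n - k + 1) * centeredSum (H 1) (multisetMoment σ π u) k := by
    intro k hk
    rw [Finset.mem_range] at hk
    rw [h.integral_skorohod_pow k (by omega)]
  rw [Finset.sum_congr rfl hM, Finset.sum_congr rfl fun a ha => Finset.sum_congr rfl fun j hj =>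
    Finset.sum_congr rfl fun b hb => Finset.sum_congr rfl fun l hl => by
      rw [hΔ a ha j hj b hb l hl]]
  have key := centered_expansion (multisetMoment σ π u) H n
  -- The term `k = n`, equal to `H 1` times the `n`-th centered moment, is isolated because it
  -- cancels the last term of `centeredSum_succ`.
  rw [Finset.sum_range_succ (fun k => (n.choose k : ℝ) * H (n - k + 1) *
    centeredSum (H 1) (multisetMoment σ π u) k) n] at key
  rw [h.integral_skorohod_pow (n + 1) (by omega), centeredSum_succ, key, Nat.choose_self,
    Nat.sub_self]
  simp only [Nat.cast_one, zero_add, one_mul]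
  ring

end IsMomentProcess

end

end PoissonInvariance

end

theorem proposition3p1
    {X : Type*} [MetricSpace X] [SigmaCompactSpace X] [MeasurableSpace X] [BorelSpace X]
    (σ : Measure X) [SigmaFinite σ] [NullSingletonClass σ]
    {Y : Type*} [MeasurableSpace Y] (μ : Measure Y)
    (π : Measure (PoissonInvariance.Configuration X)) (hπ : PoissonInvariance.IsPoisson σ π)
    (N : ℕ) (R : PoissonInvariance.RandomIsometry N μ σ)
    (h : Y → ℝ) (hh : ∀ p : Fin (N + 1), MemLp h (((p : ℕ) : ℝ≥0∞) + 1) μ)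
    (u : PoissonInvariance.Configuration X → X → ℝ)
    (hu : PoissonInvariance.IsVersion π R h hh u)
    (hu_mem : PoissonInvariance.MemL21 σ π u)
    (hu_bdd : ∃ M : ℝ, ∀ᵐ ω ∂π, ∀ᵐ x ∂σ, |u ω x| ≤ M)
    (hbound : ∀ (a : ℕ) (l : Fin (a + 1) → ℕ), (∀ p, 1 ≤ l p) → ∑ p, l p ≤ N + 1 →
      ∫⁻ ω, ∫⁻ s : Fin (a + 1) → X,
          ‖PoissonInvariance.bigDelta (fun p η x => u η x ^ l p) s ω‖ₑ
        ∂(Measure.pi fun _ => σ) ∂π < ∞)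
    (n : ℕ) (hn : n ≤ N) :
    MemLp (PoissonInvariance.skorohod σ u) ((n : ℝ≥0∞) + 1) π ∧
    ∫ ω, PoissonInvariance.skorohod σ u ω ^ (n + 1) ∂π =
      ∑ k ∈ Finset.range n,
        (n.choose k : ℝ) * (∫ y, h y ^ (n - k + 1) ∂μ) *
          ∫ ω, PoissonInvariance.skorohod σ u ω ^ k ∂π +
      ∑ a ∈ Finset.range (n + 1), ∑ j ∈ Finset.range (a + 1), ∑ b ∈ Finset.Icc a n,
        ∑ l ∈ Finset.Nat.antidiagonalTuple (a + 1) (n - b),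
          (a.choose j : ℝ) * PoissonInvariance.coeffC n a (b - a) l *
          (∏ q ∈ Finset.Icc (j + 1) b,
            ∫ y, h y ^ (1 + PoissonInvariance.extendZero l q) ∂μ) *
          ∫ ω, ∫ s : Fin (j + 1) → X,
            PoissonInvariance.bigDelta
              (fun p η x => u η x ^ (1 + PoissonInvariance.extendZero l p)) s ω
            ∂(Measure.pi fun _ => σ) ∂π := by
  have hM : PoissonInvariance.IsMomentProcess σ π u N (fun k => ∫⁻ y, ‖h y‖ₑ ^ k ∂μ)
      (fun k => ∫ y, h y ^ k ∂μ) := {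
    isPoisson := hπ
    measurable := hu_mem.measurable
    lt_top := fun k hk hkN => by
      obtain ⟨p, rfl⟩ : ∃ p, k = p + 1 := ⟨k - 1, by omega⟩
      exact PoissonInvariance.lintegral_pow_lt_top p (hh ⟨p, by omega⟩)
    hasMoments := hu.hasMoments
    bigDelta_lt_top := hbound }
  exact ⟨hM.memLp_skorohod n hn, hM.integral_skorohod_pow_succ n hn⟩
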